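/- Consider $\min_{x\in\mathbb{R}^n}\Phi(x)=f(g(x))+h(x)$ with $g=\frac1N\sum_{j=1}^N g_j$, where $f:\mathbb{R}^m\to\mathbb{R}$ is convex and $l_f$-Lipschitz, $h:\mathbb{R}^n\to\mathbb{R}\cup\{+\infty\}$ is closed, convex and proper, the $g_j:\mathbb{R}^n\to\mathbb{R}^m$ are differentiable, $g$ is $l_g$-Lipschitz, $g'$ is $L_g$-Lipschitz in operator norm, every $g_j$ is $\hat l_g$-Lipschitz, and every $g_j'$ is $\hat L_g$-Lipschitz in operator norm. Let $M>5l_fL_g$, let $\inf\Phi>-\infty$, and let $x_0^0$ be an initial point with $\Phi(x_0^0)-\inf\Phi\le D<\infty$. Define $\mathcal G_M(x)=M(x-x_+)$ with $x_+=\operatorname{argmin}_y\{f(g(x)+g'(x)(y-x))+h(y)+\frac M2\|y-x\|_2^2\}$. Method: for $k=0,\dots,K-1$ and $i=0,\dots,\tau-1$, form estimates $\tilde g_i^k,\tilde J_i^k$ of $g(x_i^k),g'(x_i^k)$ and let $x_{i+1}^k$ be the output of a randomized solver applied to $s_i^k(x)=f(\tilde g_i^k+\tilde J_i^k(x-x_i^k))+h(x)+\frac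 M2\|x-x_i^k\|_2^2$; then put $x_0^{k+1}=x_\tau^k$. The solver satisfies: for all $\bar\epsilon,\bar\delta>0$ and every subproblem $s$ of this form, its output $x$ satisfies $s(x)\le\inf s+\bar\epsilon$ with probability at least $1-\bar\delta$. The estimates are exact for $i=0$, i.e. $\tilde g_0^k=\frac1N\sum_j g_j(x_0^k)$, $\tilde J_0^k=\frac1N\sum_j g_j'(x_0^k)$, with all summands stored. For $i>0$, $$\tilde g_i^k=\tfrac1a\sum_{j\in\mathcal A_i^k}\bigl(g_j(x_i^k)-g_j(x_0^k)\bigr)+\tilde g_0^k,\qquad \tilde J_i^k=\tfrac1b\sum_{j\in\mathcal B_i^k}\bigl(g_j'(x_i^k)-g_j'(x_0^k)\bigr)+\tilde J_0^k,$$ where $\mathcal A_i^k,\mathcal B_i^k$ are fresh samples, with replacement, of sizes $a$ and $b$ from $\{1,\dots,N\}$, and the values at $x_0^k$ are read from memory. Then there are positive constants $C_\Sigma,C_a,C_b,C,\epsilon_0$, depending only on $l_f,l_g,L_g,\hat l_g,\hat L_g,M,D$, such that for all such problems, initial points and solvers (for any $n,m$ and $N\ge1$), all $\Delta\in(0,1)$,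 all integers $\tau\ge1$ and all $\epsilon\in(0,\epsilon_0]$ the following holds. With $$K=\Bigl\lceil\tfrac{C_\Sigma\epsilon^{-1}}{\tau}\Bigr\rceil,\quad a=\Bigl\lceil C_a\tau^2\epsilon^{-1}\log\tfrac{4(m+1)K\tau}{\Delta}\Bigr\rceil,\quad b=\Bigl\lceil C_b\tau^2\log\tfrac{4(m+n)K\tau}{\Delta}\Bigr\rceil,\quad \bar\delta=\tfrac{\Delta}{2K\tau},\quad \bar\epsilon=\tfrac{\epsilon}{5\cdot30M}$$ (where $\log 0$ is read as $0$, which matters only for $m=n=0$): (i) with probability at least $1-\Delta$, $\displaystyle\frac1{K\tau}\sum_{k=0}^{K-1}\sum_{i=0}^{\tau-1}\|\mathcal G_M(x_i^k)\|_2^2\le\epsilon$; (ii) with the logarithmic factor $\Lambda=1+\log\frac{(m+n+1)\tau}{\epsilon\Delta}$, the total numbers of evaluations of components $g_j(\cdot)$ and of Jacobians $g_j'(\cdot)$ are, respectively, at most $$C\Lambda\left(N+\epsilon^{-1}\tau^3+N\epsilon^{-1}\tau^{-1}+\epsilon^{-2}\tau^2\right)\quad\text{and}\quad C\Lambda\left(N+\tau^3+N\epsilon^{-1}\tau^{-1}+\epsilon^{-1}\tau^2\right).$$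 -/

import Mathlib

open MeasureTheory Set
open scoped NNReal ENNReal BigOperators

noncomputable section

namespace ProxSVRG

/-- `ℝᵈ` with its Euclidean norm. -/
abbrev E (d : ℕ) : Type := EuclideanSpace ℝ (Fin d)

/-- Linear maps `ℝⁿ → ℝᵐ` (Jacobians), with the operator (spectral) norm. -/
abbrev Jac (n m : ℕ) : Type := E n →L[ℝ] E m

/-- The average of finitely many vectors (`0` for an empty family). -/
def avg {V : Type*} [AddCommGroup V] [Module ℝ V] {r : ℕ} (v : Fin r → V) : V :=
  (r : ℝ)⁻¹ • ∑ j, v j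

/-! ### The composite problem `min f(g(x)) + h(x)`, `g = (1/N) ∑ gⱼ` -/

/-- Data of a finite-sum composite problem; `h` takes values in `ℝ ∪ {+∞}`
(the value `-∞` is excluded in `Problem.Standing`). -/
structure Problem (n m N : ℕ) where
  /-- the outer function -/
  f : E m → ℝ
  /-- the inner components `gⱼ` -/
  comp : Fin N → E n → E m
  /-- the regularizer -/
  h : E n → EReal

namespace Problem

variable {n m N : ℕ}

/-- The inner function `g(x) = (1/N) ∑ⱼ gⱼ(x)`. -/
def g (P : Problem n m N) (x : E n) : E m := avg fun j => P.comp j x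

/-- The objective `Φ(x) = f(g(x)) + h(x)`. -/
def obj (P : Problem n m N) (x : E n) : EReal := (P.f (P.g x) : EReal) + P.h x

/-- The function `x ↦ f(u + J (x - c)) + h(x) + (M/2) ‖x - c‖²`. -/
def model (P : Problem n m N) (M : ℝ) (u : E m) (J : Jac n m) (c : E n) : E n → EReal :=
  fun x => (P.f (u + J (x - c)) : EReal) + P.h x + ((M / 2 * ‖x - c‖ ^ 2 : ℝ) : EReal)

/-- The exact prox-linear step `x₊`: the minimizer of
`y ↦ f(g(x) + g'(x)(y - x)) + h(y) + (M/2) ‖y - x‖²`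
(`Classical.epsilon` selects a point with the stated property if there is one and is
unspecified otherwise). -/
def proxPoint (P : Problem n m N) (M : ℝ) (x : E n) : E n :=
  Classical.epsilon fun y => IsMinOn (P.model M (P.g x) (fderiv ℝ P.g x) x) univ y

/-- The generalized gradient `𝒢_M(x) = M (x - x₊)`. -/
def genGrad (P : Problem n m N) (M : ℝ) (x : E n) : E n := M • (x - P.proxPoint M x)

/-- Standing conditions on `f`, `g`, `h`, together with the uniform Lipschitz conditions on
the components `gⱼ` and their Jacobians. -/
structure Standing (P : Problem n m N) (lf lg Lg lhat Lhat : ℝ≥0) : Prop where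
  f_convex : ConvexOn ℝ univ P.f
  f_lipschitz : LipschitzWith lf P.f
  comp_differentiable : ∀ j, Differentiable ℝ (P.comp j)
  g_lipschitz : LipschitzWith lg P.g
  jac_lipschitz : LipschitzWith Lg (fderiv ℝ P.g)
  comp_lipschitz : ∀ j, LipschitzWith lhat (P.comp j)
  comp_jac_lipschitz : ∀ j, LipschitzWith Lhat (fderiv ℝ (P.comp j))
  /-- `h` is proper -/
  h_ne_bot : ∀ x, P.h x ≠ ⊥
  h_proper : ∃ x, P.h x ≠ ⊤
  /-- `h` is closed -/
  h_closed : LowerSemicontinuous P.h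
  /-- `h` is convex: its epigraph is convex -/
  h_convex : Convex ℝ {p : E n × ℝ | P.h p.1 ≤ (p.2 : EReal)}

end Problem

/-! ### Randomized solver of the subproblems -/

/-- A randomized solver: from an objective `s`, tolerances `ε̄`, `δ̄` and a random seed it
produces a point. -/
abbrev Solver (n : ℕ) (S : Type*) : Type _ := (E n → EReal) → ℝ → ℝ → S → E n

/-- For all tolerances `ε̄, δ̄ > 0` and each prox-linear subproblem `s`, the solver returns with
probability at least `1 - δ̄` (over its seed, of law `ν`) a point `x` with
`s x ≤ inf s + ε̄`. The output depends measurably on the subproblem data and the seed. -/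
structure SolverGuarantee {n m N : ℕ} {S : Type*} [MeasurableSpace S] (P : Problem n m N)
    (M : ℝ) (ν : Measure S) (solver : Solver n S) : Prop where
  measurable : ∀ εbar > 0, ∀ δbar > 0,
    Measurable fun p : (E m × Jac n m × E n) × S =>
      solver (P.model M p.1.1 p.1.2.1 p.1.2.2) εbar δbar p.2
  near_optimal : ∀ εbar > 0, ∀ δbar > 0, ∀ (u : E m) (J : Jac n m) (c : E n),
    ENNReal.ofReal (1 - δbar) ≤
      ν {ζ | P.model M u J c (solver (P.model M u J c) εbar δbar ζ) ≤
        (⨅ y, P.model M u J c y) + (εbar : EReal)}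

/-! ### Computations that count oracle calls -/

/-- A result together with the numbers of component evaluations `gⱼ(·)` and of component
Jacobians `gⱼ'(·)` that were requested to obtain it. -/
structure Counted (α : Type*) where
  val : α
  evals : ℕ
  jacs : ℕ

namespace Counted

instance : Monad Counted where
  pure v := ⟨v, 0, 0⟩
  bind c k := ⟨(k c.val).val, c.evals + (k c.val).evals, c.jacs + (k c.val).jacs⟩

/-- Carry out a finite family of computations. -/
def all {r : ℕ} {α : Type*} (c : Fin r → Counted α) : Counted (Fin r → α) :=
  ⟨fun j => (c j).val, ∑ j, (c j).evals, ∑ j, (c j).jacs⟩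

end Counted

section Algorithm

variable {n m N : ℕ}

/-- One oracle call for the value `gⱼ(x)`. -/
def evalOracle (P : Problem n m N) (j : Fin N) (x : E n) : Counted (E m) :=
  ⟨P.comp j x, 1, 0⟩

/-- One oracle call for the Jacobian `gⱼ'(x)`. -/
def jacOracle (P : Problem n m N) (j : Fin N) (x : E n) : Counted (Jac n m) :=
  ⟨fderiv ℝ (P.comp j) x, 0, 1⟩

/-- What is stored during an epoch: all `gⱼ(x₀)` and `gⱼ'(x₀)` at the epoch's first point. -/
structure Memory (n m N : ℕ) where
  values : Fin N → E m
  jacobians : Fin N → Jac n m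

/-- The full evaluation at the first point of an epoch. -/
def snapshot (P : Problem n m N) (x : E n) : Counted (Memory n m N) := do
  let gs ← Counted.all fun j => evalOracle P j x
  let Js ← Counted.all fun j => jacOracle P j x
  return ⟨gs, Js⟩

/-- The estimator of `(g(x), g'(x))` at inner iteration `i`, with batches `A` and `B`: exact
for `i = 0`, variance-reduced for `i > 0`; values at the first point of the epoch are taken
from memory. -/
def estimate (P : Problem n m N) {a b : ℕ} (mem : Memory n m N) (i : ℕ) (x : E n)
    (A : Fin a → Fin N) (B : Fin b → Fin N) : Counted (E m × Jac n m) :=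
  if i = 0 then
    pure (avg mem.values, avg mem.jacobians)
  else do
    let us ← Counted.all fun r => evalOracle P (A r) x
    let Vs ← Counted.all fun r => jacOracle P (B r) x
    return (avg (fun r => us r - mem.values (A r)) + avg mem.values,
      avg (fun r => Vs r - mem.jacobians (B r)) + avg mem.jacobians)

/-- The randomness used in one inner iteration: two batches and a solver seed. -/
abbrev Noise (N a b : ℕ) (S : Type*) : Type _ := (Fin a → Fin N) × (Fin b → Fin N) × S

variable {a b : ℕ} {S : Type*}

/-- `innerLoop … i` is the `i`-th point of an epoch that starts at `x₀`. -/
def innerLoop (P : Problem n m N) (M : ℝ) (solver : Solver n S) (εbar δbar : ℝ)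
    (mem : Memory n m N) (x₀ : E n) (z : ℕ → Noise N a b S) : ℕ → Counted (E n)
  | 0 => pure x₀
  | i + 1 => do
      let x ← innerLoop P M solver εbar δbar mem x₀ z i
      let est ← estimate P mem i x (z i).1 (z i).2.1
      return solver (P.model M est.1 est.2 x) εbar δbar (z i).2.2

/-- The full evaluation at `x₀`, followed by `i` inner iterations. -/
def epoch (P : Problem n m N) (M : ℝ) (solver : Solver n S) (εbar δbar : ℝ)
    (x₀ : E n) (z : ℕ → Noise N a b S) (i : ℕ) : Counted (E n) := do
  let mem ← snapshot P x₀
  innerLoop P M solver εbar δbar mem x₀ z i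

/-- The method after `k` complete epochs of length `τ`; its value is `x₀ᵏ`. The randomness
used at iteration `(k, i)` is `ω (k, i)`. -/
def method (P : Problem n m N) (M : ℝ) (solver : Solver n S) (εbar δbar : ℝ) (τ : ℕ)
    (x₀ : E n) (ω : ℕ × ℕ → Noise N a b S) : ℕ → Counted (E n)
  | 0 => pure x₀
  | k + 1 => do
      let x ← method P M solver εbar δbar τ x₀ ω k
      epoch P M solver εbar δbar x (fun i => ω (k, i)) τ

/-- The iterate `xᵢᵏ`. -/
def iterate (P : Problem n m N) (M : ℝ) (solver : Solver n S) (εbar δbar : ℝ) (τ : ℕ)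
    (x₀ : E n) (ω : ℕ × ℕ → Noise N a b S) (k i : ℕ) : E n :=
  (epoch P M solver εbar δbar (method P M solver εbar δbar τ x₀ ω k).val
    (fun i => ω (k, i)) i).val

/-- The law of the randomness of one iteration: `a` and `b` independent uniform indices (sampling
with replacement) and an independent seed. -/
def noiseLaw (N a b : ℕ) [NeZero N] [MeasurableSpace S] (ν : Measure S) :
    Measure (Noise N a b S) :=
  (Measure.pi fun _ : Fin a => (PMF.uniformOfFintype (Fin N)).toMeasure).prod
    ((Measure.pi fun _ : Fin b => (PMF.uniformOfFintype (Fin N)).toMeasure).prod ν)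

instance [NeZero N] [MeasurableSpace S] (ν : Measure S) [IsProbabilityMeasure ν] :
    IsProbabilityMeasure (noiseLaw N a b ν) := by
  unfold noiseLaw; infer_instance

/-- The law of all the randomness: independent copies for the iterations `(k, i)`. -/
def runLaw (N a b : ℕ) [NeZero N] [MeasurableSpace S] (ν : Measure S) [IsProbabilityMeasure ν] :
    Measure (ℕ × ℕ → Noise N a b S) :=
  Measure.infinitePi fun _ => noiseLaw N a b ν

end Algorithm

end ProxSVRG

end

/-! The argument has a deterministic half and a probabilistic half, which meet at the notion of an
accurate step (`StepAccurate`).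

Deterministic half. Let `p` be the exact prox-linear point of `x` and `x̂` an `ε̄`-minimizer of the
model built from estimates. Strong convexity of the exact model at `p`, the linearization error `l_f
L_g < M/5`, and the comparison of `x̂` with `p` in the approximate model give `Standing.descent`:
`Φ` drops by `(M/2)‖p - x‖² + (3M/10)‖x̂ - x‖²` up to the estimation errors and `ε̄`. In an accurate
step the estimation errors are at most small multiples of `‖x_i - x_0‖/τ`, up to a factor `√ε` for
values. By Cauchy-Schwarz the squares of these ratios sum over an epoch to at most `∑ ‖x_{i+1} -
x_i‖²`, so the descent terms absorb them (`epoch_sum_le`). Telescoping over all epochs bounds `∑ ‖p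
- x‖²`, and `‖𝒢_M‖ = M‖p - x‖`.

Probabilistic half. The sampled terms `g_j(x) - g_j(x_0)` and their Jacobian analogues have size
proportional to `‖x - x_0‖`, so a batch mean with small relative deviation is accurate in the
required sense. The deviation bound is a matrix concentration inequality proved by exchangeable
pairs: resampling one index yields a recursion for `E tr S^{2p}` (`sum_trace_pow_le`), and Markov's
inequality with `p` of order `log((m+n)/δ)` gives the tail (`measure_deviation_le`). Since `x_i^k`
does not depend on the noise of iteration `(k, i)`, the fixed-state bound applies along the run
(`infinitePi_state_le`), and a union bound over the `Kτ` iterations finishes (`convergence`). The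
oracle counts follow from `K (N + τ a)` and `K (N + τ b)`. -/

namespace ProxSVRG

/-! ### Trace inequalities for powers of symmetric matrices -/

section Trace

variable {ι : Type*} [Fintype ι] [DecidableEq ι]

lemma exists_orthogonal_diagonalization {H : Matrix ι ι ℝ} (hH : H.IsSymm) :
    ∃ (U : Matrix ι ι ℝ) (l : ι → ℝ), U.transpose * U = 1 ∧ U * U.transpose = 1 ∧
      ∀ q : ℕ, H ^ q = U * Matrix.diagonal (fun i => l i ^ q) * U.transpose := by
  have hH' : H.IsHermitian := by
    rw [Matrix.IsHermitian, Matrix.conjTranspose_eq_transpose_of_trivial]; exact hH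
  set U : Matrix ι ι ℝ := (hH'.eigenvectorUnitary : Matrix ι ι ℝ) with hU
  have h1 : U.transpose * U = 1 := by
    have := Unitary.coe_star_mul_self hH'.eigenvectorUnitary
    rwa [Matrix.star_eq_conjTranspose, Matrix.conjTranspose_eq_transpose_of_trivial] at this
  have h2 : U * U.transpose = 1 := by
    have : U * star U = 1 := Unitary.coe_mul_star_self hH'.eigenvectorUnitary
    rwa [Matrix.star_eq_conjTranspose, Matrix.conjTranspose_eq_transpose_of_trivial] at this
  have h3 : H = U * Matrix.diagonal hH'.eigenvalues * U.transpose := by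
    have := hH'.spectral_theorem
    rw [Unitary.conjStarAlgAut_apply, Matrix.star_eq_conjTranspose,
      Matrix.conjTranspose_eq_transpose_of_trivial] at this
    exact this
  refine ⟨U, hH'.eigenvalues, h1, h2, fun q => ?_⟩
  induction q with
  | zero => simp [h2]
  | succ q ih =>
    rw [pow_succ, ih]
    conv_lhs => rhs; rw [h3]
    calc _ = U * Matrix.diagonal (fun i => hH'.eigenvalues i ^ q) * (U.transpose * U) *
          Matrix.diagonal hH'.eigenvalues * U.transpose := by simp only [Matrix.mul_assoc]
      _ = _ := by
          rw [h1, Matrix.mul_one, Matrix.mul_assoc U, Matrix.diagonal_mul_diagonal]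
          simp only [pow_succ]

/-- Joint spectral expansion of `tr (A Hᵠ A Yʳ)` with nonnegative weights. -/
lemma exists_trace_expansion {A H Y : Matrix ι ι ℝ} (hA : A.IsSymm) (hH : H.IsSymm)
    (hY : Y.IsSymm) : ∃ (w : ι → ι → ℝ) (l k : ι → ℝ), (∀ i j, 0 ≤ w i j) ∧
      ∀ q r : ℕ, (A * H ^ q * A * Y ^ r).trace = ∑ i, ∑ j, w i j * (l j ^ q * k i ^ r) := by
  obtain ⟨U, l, -, -, hU⟩ := exists_orthogonal_diagonalization hH
  obtain ⟨V, k, -, -, hV⟩ := exists_orthogonal_diagonalization hY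
  set W := V.transpose * A * U with hW
  have hWt : W.transpose = U.transpose * A * V := by
    simp only [hW, Matrix.transpose_mul, Matrix.transpose_transpose, hA.eq, Matrix.mul_assoc]
  -- The weight is the squared entry of `A` between eigenvector `i` of `Y` and eigenvector `j` of
  -- `H`.
  refine ⟨fun i j => W i j ^ 2, l, k, fun i j => sq_nonneg _, fun q r => ?_⟩
  calc (A * H ^ q * A * Y ^ r).trace
      = ((A * U * Matrix.diagonal (fun i => l i ^ q) * U.transpose * A * V *
          Matrix.diagonal (fun i => k i ^ r)) * V.transpose).trace := by
        rw [hU, hV]; simp only [Matrix.mul_assoc]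
    _ = (W * Matrix.diagonal (fun i => l i ^ q) * W.transpose *
          Matrix.diagonal (fun i => k i ^ r)).trace := by
        rw [Matrix.trace_mul_comm, hWt, hW]; simp only [Matrix.mul_assoc]
    _ = _ := by
        simp only [Matrix.trace, Matrix.diag_apply, Matrix.mul_diagonal]
        refine Finset.sum_congr rfl fun i _ => ?_
        rw [Matrix.mul_apply, Finset.sum_mul]
        refine Finset.sum_congr rfl fun j _ => ?_
        rw [Matrix.mul_diagonal, Matrix.transpose_apply]; ring

/-- Rearrangement: powers of `|x|` and `|y|` are ordered alike, so `(|x|^q - |y|^q)(|x|^r - |y|^r) ≥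
0` with `q + r = 2u`. The even total degree removes the absolute values on the right. -/
lemma pow_mul_pow_add_le (x y : ℝ) {u q : ℕ} (hq : q ≤ 2 * u) :
    x ^ q * y ^ (2 * u - q) + x ^ (2 * u - q) * y ^ q ≤ x ^ (2 * u) + y ^ (2 * u) := by
  obtain ⟨r, hr⟩ := Nat.exists_eq_add_of_le hq
  have hr' : 2 * u - q = r := by omega
  rw [hr']
  have h1 : x ^ q * y ^ r + x ^ r * y ^ q ≤ |x| ^ q * |y| ^ r + |x| ^ r * |y| ^ q := by
    simp only [← abs_pow, ← abs_mul]
    exact add_le_add (le_abs_self _) (le_abs_self _)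
  have h2 : x ^ (2 * u) = |x| ^ q * |x| ^ r := by
    rw [← pow_add, ← hr, pow_mul, pow_mul, sq_abs]
  have h3 : y ^ (2 * u) = |y| ^ q * |y| ^ r := by
    rw [← pow_add, ← hr, pow_mul, pow_mul, sq_abs]
  rw [h2, h3]
  refine h1.trans ?_
  have h4 : 0 ≤ (|x| ^ q - |y| ^ q) * (|x| ^ r - |y| ^ r) := by
    rcases le_total |x| |y| with h | h
    · exact mul_nonneg_of_nonpos_of_nonpos
        (sub_nonpos.2 (pow_le_pow_left₀ (abs_nonneg _) h _))
        (sub_nonpos.2 (pow_le_pow_left₀ (abs_nonneg _) h _))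
    · exact mul_nonneg (sub_nonneg.2 (pow_le_pow_left₀ (abs_nonneg _) h _))
        (sub_nonneg.2 (pow_le_pow_left₀ (abs_nonneg _) h _))
  nlinarith

lemma sum_pow_mul_pow_le (x y : ℝ) (u : ℕ) :
    ∑ q ∈ Finset.range (2 * u + 1), x ^ q * y ^ (2 * u - q) ≤
      (2 * u + 1) / 2 * (x ^ (2 * u) + y ^ (2 * u)) := by
  have h1 : ∑ q ∈ Finset.range (2 * u + 1), x ^ q * y ^ (2 * u - q) =
      ∑ q ∈ Finset.range (2 * u + 1), x ^ (2 * u - q) * y ^ q := by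
    rw [← Finset.sum_range_reflect]
    refine Finset.sum_congr rfl fun q hq => ?_
    have hq' := Finset.mem_range.1 hq
    congr 2
    omega
  have h2 : ∑ q ∈ Finset.range (2 * u + 1),
      (x ^ q * y ^ (2 * u - q) + x ^ (2 * u - q) * y ^ q) ≤
      ∑ q ∈ Finset.range (2 * u + 1), (x ^ (2 * u) + y ^ (2 * u)) :=
    Finset.sum_le_sum fun q hq => pow_mul_pow_add_le x y (by
      have := Finset.mem_range.1 hq; omega)
  rw [Finset.sum_add_distrib, ← h1, Finset.sum_const, Finset.card_range, nsmul_eq_mul] at h2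
  push_cast at h2
  linarith

lemma pow_sub_pow_eq_sum (H Y : Matrix ι ι ℝ) (u : ℕ) :
    H ^ u - Y ^ u = ∑ q ∈ Finset.range u, H ^ q * (H - Y) * Y ^ (u - 1 - q) := by
  induction u with
  | zero => simp
  | succ u ih =>
    have h : H ^ (u + 1) - Y ^ (u + 1) = (H ^ u - Y ^ u) * Y + H ^ u * (H - Y) := by
      rw [pow_succ, pow_succ]; noncomm_ring
    rw [h, ih, Finset.sum_range_succ, Finset.sum_mul]
    congr 1
    · refine Finset.sum_congr rfl fun q hq => ?_
      have hq' := Finset.mem_range.1 hq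
      rw [Matrix.mul_assoc, ← pow_succ]
      congr 2; omega
    · simp

/-- A mean value inequality under the trace. Telescoping `H^(2u+1) - Y^(2u+1)` and expanding in the
eigenbases of `H` and `Y` turns both sides into sums with the same nonnegative weights, which
reduces the claim to the scalar `sum_pow_mul_pow_le`. -/
lemma trace_sub_mul_pow_sub_pow_le {H Y : Matrix ι ι ℝ} (hH : H.IsSymm) (hY : Y.IsSymm) (u : ℕ) :
    ((H - Y) * (H ^ (2 * u + 1) - Y ^ (2 * u + 1))).trace ≤
      (2 * u + 1) / 2 * (((H - Y) * H ^ (2 * u) * (H - Y)).trace +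
        ((H - Y) * Y ^ (2 * u) * (H - Y)).trace) := by
  obtain ⟨w, l, k, hw, h⟩ := exists_trace_expansion (hH.sub hY) hH hY
  have h1 : ((H - Y) * (H ^ (2 * u + 1) - Y ^ (2 * u + 1))).trace =
      ∑ i, ∑ j, w i j * ∑ q ∈ Finset.range (2 * u + 1), l j ^ q * k i ^ (2 * u - q) := by
    rw [pow_sub_pow_eq_sum, Finset.mul_sum, Matrix.trace_sum]
    simp only [Finset.mul_sum]
    rw [Finset.sum_congr rfl fun i _ => Finset.sum_comm, Finset.sum_comm]
    refine Finset.sum_congr rfl fun q _ => ?_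
    rw [← h, ← Matrix.mul_assoc, ← Matrix.mul_assoc]
    simp
  have h2 : ((H - Y) * H ^ (2 * u) * (H - Y)).trace = ∑ i, ∑ j, w i j * l j ^ (2 * u) := by
    have := h (2 * u) 0
    simpa using this
  have h3 : ((H - Y) * Y ^ (2 * u) * (H - Y)).trace = ∑ i, ∑ j, w i j * k i ^ (2 * u) := by
    have := h 0 (2 * u)
    rw [Matrix.mul_assoc, Matrix.trace_mul_comm, Matrix.mul_assoc, Matrix.trace_mul_comm]
    simpa using this
  rw [h1, h2, h3, ← Finset.sum_add_distrib, Finset.mul_sum]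
  refine Finset.sum_le_sum fun i _ => ?_
  rw [← Finset.sum_add_distrib, Finset.mul_sum]
  refine Finset.sum_le_sum fun j _ => ?_
  have := mul_le_mul_of_nonneg_left (sum_pow_mul_pow_le (l j) (k i) u) (hw i j)
  linarith

lemma trace_even_pow_nonneg {H : Matrix ι ι ℝ} (hH : H.IsSymm) (u : ℕ) :
    0 ≤ (H ^ (2 * u)).trace := by
  have h : H ^ (2 * u) = (H ^ u).transpose * H ^ u := by
    rw [Matrix.transpose_pow, hH.eq, ← pow_add, ← two_mul]
  rw [h]
  simp only [Matrix.trace, Matrix.diag_apply, Matrix.mul_apply, Matrix.transpose_apply]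
  exact Finset.sum_nonneg fun i _ => Finset.sum_nonneg fun j _ => mul_self_nonneg _

/-- The left trace is the squared Frobenius norm of `A * H ^ u`, so `hR` can be applied column by
column. -/
lemma trace_mul_even_pow_mul_le {A H : Matrix ι ι ℝ} (hA : A.IsSymm) (hH : H.IsSymm) {R : ℝ}
    (hR : ∀ v : ι → ℝ, (A.mulVec v) ⬝ᵥ (A.mulVec v) ≤ R ^ 2 * (v ⬝ᵥ v)) (u : ℕ) :
    (A * H ^ (2 * u) * A).trace ≤ R ^ 2 * (H ^ (2 * u)).trace := by
  have hP : (H ^ u).transpose = H ^ u := by rw [Matrix.transpose_pow, hH.eq]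
  have h1 : (A * H ^ (2 * u) * A).trace = ((A * H ^ u).transpose * (A * H ^ u)).trace := by
    rw [Matrix.transpose_mul, hA.eq, hP, two_mul, pow_add, Matrix.mul_assoc, Matrix.mul_assoc,
      ← Matrix.mul_assoc, Matrix.trace_mul_comm]
  have h2 : (H ^ (2 * u)).trace = ((H ^ u).transpose * H ^ u).trace := by
    rw [hP, two_mul, pow_add]
  rw [h1, h2]
  simp only [Matrix.trace, Matrix.diag_apply]
  rw [Finset.mul_sum]
  refine Finset.sum_le_sum fun i _ => ?_
  exact hR fun j => (H ^ u) j i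

/-- The eigenvalue of largest square controls the quadratic form, and its `2p`-th power is one of
the nonnegative summands of the trace. -/
lemma mulVec_dotProduct_pow_le_trace {S : Matrix ι ι ℝ} (hS : S.IsSymm) {p : ℕ} (hp : p ≠ 0)
    (v : ι → ℝ) :
    (S.mulVec v ⬝ᵥ S.mulVec v) ^ p ≤ (S ^ (2 * p)).trace * (v ⬝ᵥ v) ^ p := by
  rcases isEmpty_or_nonempty ι with hι | hι
  · simp [dotProduct, hp]
  obtain ⟨U, l, hU1, hU2, hU⟩ := exists_orthogonal_diagonalization hS
  obtain ⟨i, -, hi⟩ := Finset.exists_max_image Finset.univ (fun i => l i ^ 2)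
    Finset.univ_nonempty
  have htr : (S ^ (2 * p)).trace = ∑ i, l i ^ (2 * p) := by
    rw [hU, Matrix.trace_mul_comm, ← Matrix.mul_assoc, hU1, Matrix.one_mul, Matrix.trace_diagonal]
  have hnorm : ∀ B : Matrix ι ι ℝ, B.mulVec v ⬝ᵥ B.mulVec v = v ⬝ᵥ (B.transpose * B).mulVec v := by
    intro B
    rw [← Matrix.mulVec_mulVec, Matrix.dotProduct_mulVec v, Matrix.vecMul_transpose]
  set c := U.transpose.mulVec v with hc
  have hcc : c ⬝ᵥ c = v ⬝ᵥ v := by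
    rw [hc, hnorm, Matrix.transpose_transpose, hU2, Matrix.one_mulVec]
  have hSS : S.mulVec v ⬝ᵥ S.mulVec v = ∑ j, l j ^ 2 * (c j * c j) := by
    rw [hnorm, hS.eq, ← sq, hU 2, ← Matrix.mulVec_mulVec, ← Matrix.mulVec_mulVec,
      Matrix.dotProduct_mulVec, ← Matrix.mulVec_transpose, ← hc]
    simp only [dotProduct, Matrix.mulVec_diagonal]
    exact Finset.sum_congr rfl fun j _ => by ring
  have h1 : S.mulVec v ⬝ᵥ S.mulVec v ≤ l i ^ 2 * (v ⬝ᵥ v) := by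
    rw [hSS, ← hcc, dotProduct, Finset.mul_sum]
    exact Finset.sum_le_sum fun j _ =>
      mul_le_mul_of_nonneg_right (hi j (Finset.mem_univ j)) (mul_self_nonneg _)
  have h0 : 0 ≤ S.mulVec v ⬝ᵥ S.mulVec v := Finset.sum_nonneg fun j _ => mul_self_nonneg _
  have hv : 0 ≤ v ⬝ᵥ v := Finset.sum_nonneg fun j _ => mul_self_nonneg _
  calc _ ≤ (l i ^ 2 * (v ⬝ᵥ v)) ^ p := pow_le_pow_left₀ h0 h1 p
    _ = l i ^ (2 * p) * (v ⬝ᵥ v) ^ p := by rw [mul_pow, ← pow_mul]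
    _ ≤ _ := by
      refine mul_le_mul_of_nonneg_right ?_ (pow_nonneg hv p)
      rw [htr]
      exact Finset.single_le_sum (f := fun i => l i ^ (2 * p))
        (fun j _ => by rw [pow_mul]; positivity) (Finset.mem_univ i)

/-! ### Moments of sums of matrices sampled with replacement -/

/-- Exchanging one sampled index with an independent copy. -/
lemma sum_exchange {J : Type*} [Fintype J] [DecidableEq J] {b : ℕ} (r : Fin b)
    (F : (Fin b → J) → J → ℝ) :
    ∑ ω : Fin b → J, ∑ j, F ω j = ∑ ω : Fin b → J, ∑ j, F (Function.update ω r j) (ω r) := by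
  rw [← Fintype.sum_prod_type', ← Fintype.sum_prod_type']
  let e : (Fin b → J) × J → (Fin b → J) × J := fun p => (Function.update p.1 r p.2, p.1 r)
  have he : Function.Involutive e := by
    rintro ⟨ω, j⟩; simp [e]
  exact (Equiv.sum_comp he.toPerm (fun p : (Fin b → J) × J => F p.1 p.2)).symm

/-- Method of exchangeable pairs. Split off one factor of the power as `∑ r, X (ω r)`. For each `r`,
centering allows `X (ω r)` to be replaced by `X (ω r) - X j` with `j` an independent copy, and the
swap of `ω r` and `j` is measure preserving and flips the sign of this factor. Antisymmetrizing
produces a difference of powers of two sums that differ by exactly `X (ω r) - X j`, to which the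
mean value trace inequality applies. -/
lemma sum_trace_pow_le {J : Type*} [Fintype J] [DecidableEq J] [Nonempty J] {b : ℕ}
    (X : J → Matrix ι ι ℝ) (hX : ∀ j, (X j).IsSymm) (h0 : ∑ j, X j = 0) {R : ℝ}
    (hR : ∀ j k, ∀ v : ι → ℝ,
      ((X j - X k).mulVec v) ⬝ᵥ ((X j - X k).mulVec v) ≤ R ^ 2 * (v ⬝ᵥ v)) (u : ℕ) :
    ∑ ω : Fin b → J, ((∑ r, X (ω r)) ^ (2 * (u + 1))).trace ≤
      (2 * u + 1) / 2 * b * R ^ 2 * ∑ ω : Fin b → J, ((∑ r, X (ω r)) ^ (2 * u)).trace := by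
  set S : (Fin b → J) → Matrix ι ι ℝ := fun ω => ∑ r, X (ω r) with hS
  have hSs : ∀ ω, (S ω).IsSymm := fun ω => by
    simp only [hS, Matrix.IsSymm, Matrix.transpose_sum]
    exact Finset.sum_congr rfl fun r _ => hX _
  have hupd : ∀ ω r j, S ω - S (Function.update ω r j) = X (ω r) - X j := by
    intro ω r j
    simp only [hS, ← Finset.sum_sub_distrib]
    rw [Finset.sum_eq_single r]
    · simp
    · intro s _ hs; simp [Function.update_of_ne hs]
    · simp
  have key : ∀ r : Fin b, (Fintype.card J : ℝ) * ∑ ω : Fin b → J,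
      (X (ω r) * S ω ^ (2 * u + 1)).trace ≤
      (Fintype.card J : ℝ) * ((2 * u + 1) / 2 * R ^ 2 * ∑ ω, (S ω ^ (2 * u)).trace) := by
    intro r
    have h1 : (Fintype.card J : ℝ) * ∑ ω : Fin b → J, (X (ω r) * S ω ^ (2 * u + 1)).trace =
        ∑ ω : Fin b → J, ∑ j, ((X (ω r) - X j) * S ω ^ (2 * u + 1)).trace := by
      rw [Finset.mul_sum]
      refine Finset.sum_congr rfl fun ω _ => ?_
      rw [← Matrix.trace_sum, ← Finset.sum_mul, Finset.sum_sub_distrib, h0, Finset.sum_const,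
        sub_zero, smul_mul_assoc, Matrix.trace_smul, nsmul_eq_mul, Finset.card_univ]
    have h2 : ∑ ω : Fin b → J, ∑ j, ((X (ω r) - X j) * S ω ^ (2 * u + 1)).trace =
        - ∑ ω : Fin b → J, ∑ j,
          ((X (ω r) - X j) * S (Function.update ω r j) ^ (2 * u + 1)).trace := by
      rw [sum_exchange r, ← Finset.sum_neg_distrib]
      refine Finset.sum_congr rfl fun ω _ => ?_
      rw [← Finset.sum_neg_distrib]
      refine Finset.sum_congr rfl fun j _ => ?_
      rw [Function.update_self, ← Matrix.trace_neg, ← Matrix.neg_mul, neg_sub]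
    have h3 : ∑ ω : Fin b → J, ∑ j, ((X (ω r) - X j) * S ω ^ (2 * u + 1)).trace =
        ∑ ω : Fin b → J, ∑ j, 1 / 2 * ((X (ω r) - X j) *
          (S ω ^ (2 * u + 1) - S (Function.update ω r j) ^ (2 * u + 1))).trace := by
      simp only [Matrix.trace_sub, mul_sub, Finset.sum_sub_distrib,
        ← Finset.mul_sum] at h2 ⊢
      linarith
    -- The quadratic terms are even in the difference, so the swap identifies the two halves of the
    -- bound.
    have h4 : ∑ ω : Fin b → J, ∑ j, ((X (ω r) - X j) * S ω ^ (2 * u) * (X (ω r) - X j)).trace =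
        ∑ ω : Fin b → J, ∑ j,
          ((X (ω r) - X j) * S (Function.update ω r j) ^ (2 * u) * (X (ω r) - X j)).trace := by
      rw [sum_exchange r]
      refine Finset.sum_congr rfl fun ω _ => Finset.sum_congr rfl fun j _ => ?_
      rw [Function.update_self, ← neg_sub (X (ω r)) (X j)]
      simp only [Matrix.neg_mul, Matrix.mul_neg, neg_neg]
    calc _ = _ := h1.trans h3
      _ ≤ ∑ ω : Fin b → J, ∑ j, 1 / 2 * ((2 * u + 1) / 2 *
            (((X (ω r) - X j) * S ω ^ (2 * u) * (X (ω r) - X j)).trace +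
            ((X (ω r) - X j) * S (Function.update ω r j) ^ (2 * u) *
              (X (ω r) - X j)).trace)) := by
          refine Finset.sum_le_sum fun ω _ => Finset.sum_le_sum fun j _ => ?_
          have := trace_sub_mul_pow_sub_pow_le (hSs ω) (hSs (Function.update ω r j)) u
          rw [hupd] at this
          linarith
      _ = (2 * u + 1) / 2 * ∑ ω : Fin b → J, ∑ j,
            ((X (ω r) - X j) * S ω ^ (2 * u) * (X (ω r) - X j)).trace := by
          simp only [← Finset.mul_sum, Finset.sum_add_distrib]
          rw [← h4]; ring
      _ ≤ (2 * u + 1) / 2 * ∑ ω : Fin b → J, ∑ _j : J, R ^ 2 * (S ω ^ (2 * u)).trace := by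
          refine mul_le_mul_of_nonneg_left ?_ (by positivity)
          exact Finset.sum_le_sum fun ω _ => Finset.sum_le_sum fun j _ =>
            trace_mul_even_pow_mul_le ((hX _).sub (hX _)) (hSs ω) (hR _ _) u
      _ = _ := by
          simp only [Finset.sum_const, nsmul_eq_mul, Finset.card_univ, ← Finset.mul_sum]
          ring
  have hJ : (0 : ℝ) < Fintype.card J := by exact_mod_cast Fintype.card_pos
  have h5 : ∀ ω, (S ω ^ (2 * (u + 1))).trace = ∑ r, (X (ω r) * S ω ^ (2 * u + 1)).trace := by
    intro ω
    rw [← Matrix.trace_sum, ← Finset.sum_mul, show 2 * (u + 1) = (2 * u + 1) + 1 by ring, pow_succ']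
  calc _ = ∑ r : Fin b, ∑ ω : Fin b → J, (X (ω r) * S ω ^ (2 * u + 1)).trace := by
        rw [Finset.sum_comm]; exact Finset.sum_congr rfl fun ω _ => h5 ω
    _ ≤ ∑ _r : Fin b, ((2 * u + 1) / 2 * R ^ 2 * ∑ ω, (S ω ^ (2 * u)).trace) :=
        Finset.sum_le_sum fun r _ => le_of_mul_le_mul_left (key r) hJ
    _ = _ := by
        rw [Finset.sum_const, nsmul_eq_mul, Finset.card_univ, Fintype.card_fin]; ring

/-- Iterating the recursion from `u = 0`, where the trace is the dimension; every factor `(2u+1)/2`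
with `u < p` is replaced by `p`. -/
lemma sum_trace_pow_le_pow {J : Type*} [Fintype J] [DecidableEq J] [Nonempty J] {b : ℕ}
    (X : J → Matrix ι ι ℝ) (hX : ∀ j, (X j).IsSymm) (h0 : ∑ j, X j = 0) {R : ℝ}
    (hR : ∀ j k, ∀ v : ι → ℝ,
      ((X j - X k).mulVec v) ⬝ᵥ ((X j - X k).mulVec v) ≤ R ^ 2 * (v ⬝ᵥ v)) (p : ℕ) :
    ∑ ω : Fin b → J, ((∑ r, X (ω r)) ^ (2 * p)).trace ≤
      (p * b * R ^ 2) ^ p * (Fintype.card J ^ b * Fintype.card ι) := by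
  suffices h : ∀ u, u ≤ p → ∑ ω : Fin b → J, ((∑ r, X (ω r)) ^ (2 * u)).trace ≤
      (p * b * R ^ 2) ^ u * (Fintype.card J ^ b * Fintype.card ι) from h p le_rfl
  intro u
  induction u with
  | zero => intro _; simp [Matrix.trace_one]
  | succ u ih =>
    intro hu
    have hup : (2 * u + 1 : ℝ) / 2 ≤ p := by
      have : (u + 1 : ℝ) ≤ p := by exact_mod_cast hu
      linarith
    have hnn : 0 ≤ (p * b * R ^ 2) ^ u * ((Fintype.card J : ℝ) ^ b * Fintype.card ι) := by positivity
    calc _ ≤ _ := sum_trace_pow_le X hX h0 hR u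
      _ ≤ (2 * u + 1) / 2 * b * R ^ 2 *
          ((p * b * R ^ 2) ^ u * (Fintype.card J ^ b * Fintype.card ι)) :=
        mul_le_mul_of_nonneg_left (ih (by omega)) (by positivity)
      _ ≤ p * b * R ^ 2 * ((p * b * R ^ 2) ^ u * (Fintype.card J ^ b * Fintype.card ι)) := by
        refine mul_le_mul_of_nonneg_right ?_ hnn
        gcongr
      _ = _ := by ring

end Trace

/-! ### Sampling bounds for Jacobians and vectors -/

section Dilation

variable {n m : ℕ}

/-- The symmetric dilation of a linear map. -/
noncomputable def dilation (J : Jac n m) : Matrix (Fin m ⊕ Fin n) (Fin m ⊕ Fin n) ℝ :=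
  Matrix.fromBlocks 0 (Matrix.of fun i j => J (EuclideanSpace.single j 1) i)
    (Matrix.of fun j i => J (EuclideanSpace.single j 1) i) 0

lemma dilation_isSymm (J : Jac n m) : (dilation J).IsSymm := by
  ext (i | i) (j | j) <;> simp [dilation, Matrix.transpose_apply]

lemma dilation_sub (J J' : Jac n m) : dilation (J - J') = dilation J - dilation J' := by
  ext (i | i) (j | j) <;> simp [dilation]

lemma dilation_sum {ι : Type*} (s : Finset ι) (J : ι → Jac n m) :
    dilation (∑ i ∈ s, J i) = ∑ i ∈ s, dilation (J i) := by
  ext (i | i) (j | j) <;> simp [dilation, Matrix.sum_apply]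

lemma dilation_zero : dilation (0 : Jac n m) = 0 := by
  ext (i | i) (j | j) <;> simp [dilation]

lemma dotProduct_self_eq_norm_sq {d : ℕ} (v : Fin d → ℝ) :
    v ⬝ᵥ v = ‖(WithLp.toLp 2 v : E d)‖ ^ 2 := by
  rw [EuclideanSpace.norm_sq_eq]
  simp [dotProduct, sq]

lemma dilation_mulVec_dotProduct (J : Jac n m) (w : Fin m → ℝ) (v : Fin n → ℝ) :
    (dilation J).mulVec (Sum.elim w v) ⬝ᵥ (dilation J).mulVec (Sum.elim w v) =
      ‖J (WithLp.toLp 2 v)‖ ^ 2 + ‖J.adjoint (WithLp.toLp 2 w)‖ ^ 2 := by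
  have h1 : (Matrix.of fun i j => J (EuclideanSpace.single j 1) i).mulVec v =
      (J (WithLp.toLp 2 v)).ofLp := by
    have hv : (WithLp.toLp 2 v : E n) = ∑ j, v j • EuclideanSpace.single j (1 : ℝ) := by
      ext i; simp [Finset.sum_apply, Pi.single_apply]
    ext i
    rw [hv]
    simp [Matrix.mulVec, dotProduct, mul_comm]
  have h2 : (Matrix.of fun j i => J (EuclideanSpace.single j 1) i).mulVec w =
      (J.adjoint (WithLp.toLp 2 w)).ofLp := by
    ext j
    have : (J.adjoint (WithLp.toLp 2 w)).ofLp j =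
        inner ℝ (EuclideanSpace.single j (1 : ℝ)) (J.adjoint (WithLp.toLp 2 w)) := by
      simp [EuclideanSpace.inner_single_left]
    rw [this, ContinuousLinearMap.adjoint_inner_right]
    simp [Matrix.mulVec, dotProduct, PiLp.inner_apply, mul_comm]
  rw [dilation, Matrix.fromBlocks_mulVec]
  simp only [Sum.elim_comp_inl, Sum.elim_comp_inr, Matrix.zero_mulVec, zero_add, add_zero]
  rw [sumElim_dotProduct_sumElim, h1, h2, dotProduct_self_eq_norm_sq,
    dotProduct_self_eq_norm_sq]

lemma dilation_mulVec_dotProduct_le (J : Jac n m) {R : ℝ} (hJ : ‖J‖ ≤ R) (v : Fin m ⊕ Fin n → ℝ) :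
    (dilation J).mulVec v ⬝ᵥ (dilation J).mulVec v ≤ R ^ 2 * (v ⬝ᵥ v) := by
  have hv : v = Sum.elim (v ∘ Sum.inl) (v ∘ Sum.inr) := by ext (i | i) <;> rfl
  have hJ' : ‖J.adjoint‖ ≤ R := by rwa [LinearIsometryEquiv.norm_map]
  rw [hv, dilation_mulVec_dotProduct, sumElim_dotProduct_sumElim,
    dotProduct_self_eq_norm_sq, dotProduct_self_eq_norm_sq, mul_add, add_comm, ← mul_pow,
    ← mul_pow]
  gcongr
  · exact ContinuousLinearMap.le_of_opNorm_le _ hJ' _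
  · exact ContinuousLinearMap.le_of_opNorm_le _ hJ _

/-- The dilation sends `(0, v)` to `(J v, 0)`, so its spectral bound dominates `‖J v‖`. Passing to
the `2p`-th root `C` of the trace puts this in the form of an operator norm bound. -/
lemma norm_pow_le_trace_dilation (J : Jac n m) {p : ℕ} (hp : p ≠ 0) :
    ‖J‖ ^ (2 * p) ≤ (dilation J ^ (2 * p)).trace := by
  set T := (dilation J ^ (2 * p)).trace with hT
  have hT0 : 0 ≤ T := trace_even_pow_nonneg (dilation_isSymm J) p
  have h2p : 2 * p ≠ 0 := by omega
  set C := T ^ (((2 * p : ℕ) : ℝ)⁻¹) with hC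
  have hC0 : 0 ≤ C := Real.rpow_nonneg hT0 _
  have hCT : C ^ (2 * p) = T := Real.rpow_inv_natCast_pow hT0 h2p
  have hJC : ‖J‖ ≤ C := by
    refine ContinuousLinearMap.opNorm_le_bound _ hC0 fun v => ?_
    have h1 := mulVec_dotProduct_pow_le_trace (dilation_isSymm J) hp (Sum.elim 0 v.ofLp)
    rw [dilation_mulVec_dotProduct, sumElim_dotProduct_sumElim,
      dotProduct_self_eq_norm_sq v.ofLp] at h1
    simp only [WithLp.toLp_zero, map_zero, norm_zero, dotProduct_zero, zero_add, ne_eq,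
      OfNat.ofNat_ne_zero, not_false_eq_true, zero_pow, add_zero, WithLp.toLp_ofLp] at h1
    rw [← pow_mul, ← pow_mul, ← hT, ← hCT, ← mul_pow] at h1
    exact (pow_le_pow_iff_left₀ (norm_nonneg _) (by positivity) h2p).1 h1
  rw [← hCT]
  exact pow_le_pow_left₀ (norm_nonneg _) hJC _

end Dilation

/-! ### Tail bounds for batches drawn with replacement -/

section Sampling

variable {n m N b : ℕ}

lemma avg_sub {V : Type*} [AddCommGroup V] [Module ℝ V] {r : ℕ} (v w : Fin r → V) :
    avg (fun j => v j - w j) = avg v - avg w := by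
  simp [avg, Finset.sum_sub_distrib, smul_sub]

lemma map_avg {V W : Type*} [AddCommGroup V] [Module ℝ V] [AddCommGroup W] [Module ℝ W]
    (f : V →ₗ[ℝ] W) {r : ℕ} (v : Fin r → V) : f (avg v) = avg fun j => f (v j) := by
  simp [avg]

lemma smul_avg {V : Type*} [AddCommGroup V] [Module ℝ V] {r : ℕ} (hr : r ≠ 0) (v : Fin r → V) :
    (r : ℝ) • avg v = ∑ j, v j := by
  rw [avg, smul_smul, mul_inv_cancel₀ (by exact_mod_cast hr), one_smul]

/-- Sampling with replacement: a large deviation of the mean is seldom. -/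
lemma card_deviation_le [NeZero N] (V : Fin N → Jac n m) {R κ : ℝ}
    (hV : ∀ j, ‖V j‖ ≤ R) (hκ : 0 < κ) {p : ℕ} (hp : p ≠ 0)
    (hb : 4 * Real.exp 1 * p ≤ b * κ ^ 2) :
    (({A | κ * R < ‖avg (fun r => V (A r)) - avg V‖} : Finset (Fin b → Fin N)).card : ℝ) ≤
      (m + n) * Real.exp (-p) * (N : ℝ) ^ b := by
  have hN : N ≠ 0 := NeZero.ne N
  have hp0 : (0 : ℝ) < p := by exact_mod_cast Nat.pos_of_ne_zero hp
  have hb0 : b ≠ 0 := by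
    rintro rfl
    have : 0 < 4 * Real.exp 1 * p := by positivity
    simp at hb; linarith
  have hb1 : (0 : ℝ) < b := by exact_mod_cast Nat.pos_of_ne_zero hb0
  have hR0 : 0 ≤ R := (norm_nonneg _).trans (hV ⟨0, Nat.pos_of_ne_zero hN⟩)
  set X : Fin N → Jac n m := fun j => V j - avg V with hX
  have hX0 : ∑ j, X j = 0 := by
    rw [hX, Finset.sum_sub_distrib, ← smul_avg hN V, Finset.sum_const, Finset.card_univ,
      Fintype.card_fin, Nat.cast_smul_eq_nsmul, sub_self]
  have hdev : ∀ A : Fin b → Fin N, (b : ℝ) • (avg (fun r => V (A r)) - avg V) = ∑ r, X (A r) := by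
    intro A
    rw [smul_sub, smul_avg hb0, hX, Finset.sum_sub_distrib, Finset.sum_const, Finset.card_univ,
      Fintype.card_fin, Nat.cast_smul_eq_nsmul]
  -- The centering cancels in `X j - X k = V j - V k`, whence the radius `2 * R`.
  have hmom := sum_trace_pow_le_pow (b := b) (fun j => dilation (X j)) (fun j => dilation_isSymm _)
    (by rw [← dilation_sum, hX0, dilation_zero]) (R := 2 * R) (fun j k v => by
      rw [← dilation_sub]
      refine dilation_mulVec_dotProduct_le _ ?_ v
      simp only [hX, sub_sub_sub_cancel_right]
      exact (norm_sub_le _ _).trans (by linarith [hV j, hV k])) p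
  simp only [Fintype.card_fin, Fintype.card_sum, Nat.cast_add] at hmom
  set B : Finset (Fin b → Fin N) := {A | κ * R < ‖avg (fun r => V (A r)) - avg V‖} with hB
  -- For `R = 0` the threshold vanishes and Markov's inequality says nothing, but all terms are zero
  -- then.
  rcases hR0.eq_or_lt with hR | hR
  · have hV0 : ∀ j, V j = 0 := fun j => norm_le_zero_iff.1 (hR ▸ hV j)
    have : B = ∅ := by
      rw [hB, Finset.filter_eq_empty_iff]
      intro A _
      simp [avg, hV0, ← hR]
    rw [this]; simp; positivity
  set Q := ((b * (κ * R)) ^ 2) ^ p with hQ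
  have hQ0 : 0 < Q := by positivity
  have h1 : (B.card : ℝ) * Q ≤
      ∑ A : Fin b → Fin N, ((∑ r, dilation (X (A r))) ^ (2 * p)).trace := by
    rw [← nsmul_eq_mul, ← Finset.sum_const]
    calc ∑ _A ∈ B, Q ≤ ∑ A ∈ B, ((∑ r, dilation (X (A r))) ^ (2 * p)).trace := by
          refine Finset.sum_le_sum fun A hA => ?_
          have hA' : κ * R < ‖avg (fun r => V (A r)) - avg V‖ := (Finset.mem_filter.1 hA).2
          rw [← dilation_sum, ← hdev]
          refine le_trans ?_ (norm_pow_le_trace_dilation _ hp)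
          rw [hQ, ← pow_mul, norm_smul, Real.norm_of_nonneg hb1.le]
          gcongr
      _ ≤ _ := by
          refine Finset.sum_le_sum_of_subset_of_nonneg (Finset.subset_univ _) fun A _ _ => ?_
          rw [← dilation_sum]
          exact trace_even_pow_nonneg (dilation_isSymm _) p
  -- The batch size makes the ratio of moment base to squared threshold, `4p / (b κ²)`, at most
  -- `1/e`.
  have h2 : (p * b * (2 * R) ^ 2) ^ p ≤ Real.exp (-p) * Q := by
    have : p * b * (2 * R) ^ 2 ≤ Real.exp (-1) * (b * (κ * R)) ^ 2 := by
      have h3 : 4 * p ≤ Real.exp (-1) * (b * κ ^ 2) := by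
        calc (4 : ℝ) * p = Real.exp (-1) * (4 * Real.exp 1 * p) := by
              rw [Real.exp_neg]; field_simp
          _ ≤ _ := by gcongr
      have := mul_le_mul_of_nonneg_right h3 (by positivity : 0 ≤ b * R ^ 2)
      linarith
    calc _ ≤ (Real.exp (-1) * (b * (κ * R)) ^ 2) ^ p := by gcongr
      _ = _ := by rw [mul_pow, ← Real.exp_nat_mul]; simp [hQ]
  refine le_of_mul_le_mul_right ?_ hQ0
  calc _ ≤ _ := h1.trans hmom
    _ ≤ Real.exp (-p) * Q * (N ^ b * (m + n)) := by gcongr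
    _ = _ := by ring

lemma pi_uniform_apply [NeZero N] (s : Finset (Fin b → Fin N)) :
    (Measure.pi fun _ : Fin b => (PMF.uniformOfFintype (Fin N)).toMeasure) s =
      ENNReal.ofReal (s.card / (N : ℝ) ^ b) := by
  have hN : (0 : ℝ) < N := by exact_mod_cast Nat.pos_of_ne_zero (NeZero.ne N)
  rw [← sum_measure_singleton]
  have : ∀ A : Fin b → Fin N,
      (Measure.pi fun _ : Fin b => (PMF.uniformOfFintype (Fin N)).toMeasure) {A} =
        ENNReal.ofReal (((N : ℝ) ^ b)⁻¹) := by
    intro A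
    rw [Measure.pi_singleton]
    simp only [PMF.toMeasure_apply_singleton _ _ (measurableSet_singleton _),
      PMF.uniformOfFintype_apply, Fintype.card_fin, Finset.prod_const, Finset.card_univ]
    rw [ENNReal.ofReal_inv_of_pos (by positivity), ENNReal.ofReal_pow hN.le,
      ENNReal.ofReal_natCast, ENNReal.inv_pow]
  simp only [this, Finset.sum_const, nsmul_eq_mul]
  rw [div_eq_mul_inv, ENNReal.ofReal_mul (by positivity), ENNReal.ofReal_natCast]

/-- The moment order is `p = ⌈log((m+n)/δ)⌉`, which turns `(m+n) e^{-p}` into at most `δ`. As the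
logarithm is at least `1`, `p` is at most twice it; this doubles the constant `4e` to `8e`. -/
lemma measure_deviation_le [NeZero N] (V : Fin N → Jac n m) {R κ δ : ℝ}
    (hV : ∀ j, ‖V j‖ ≤ R) (hκ : 0 < κ) (hδ : 0 < δ) (hl : 1 ≤ Real.log ((m + n) / δ))
    (hb : 8 * Real.exp 1 * Real.log ((m + n) / δ) ≤ b * κ ^ 2) :
    (Measure.pi fun _ : Fin b => (PMF.uniformOfFintype (Fin N)).toMeasure)
      {A | κ * R < ‖avg (fun r => V (A r)) - avg V‖} ≤ ENNReal.ofReal δ := by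
  set l := Real.log ((m + n) / δ) with hl'
  have hN : (0 : ℝ) < N := by exact_mod_cast Nat.pos_of_ne_zero (NeZero.ne N)
  have hmn : (0 : ℝ) < m + n := by
    by_contra h
    have : (m + n : ℝ) = 0 := le_antisymm (not_lt.1 h) (by positivity)
    simp [hl', this] at hl
    linarith
  have hp : ⌈l⌉₊ ≠ 0 := by
    have := Nat.ceil_pos.2 (zero_lt_one.trans_le hl); omega
  have hpl : (⌈l⌉₊ : ℝ) ≤ 2 * l := by
    have := (Nat.ceil_lt_add_one (zero_le_one.trans hl)).le; linarith
  have h := card_deviation_le (b := b) V hV hκ hp (by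
    refine le_trans ?_ hb
    have := mul_le_mul_of_nonneg_left hpl (by positivity : 0 ≤ 4 * Real.exp 1)
    linarith)
  have hset : {A | κ * R < ‖avg (fun r => V (A r)) - avg V‖} =
      ((({A | κ * R < ‖avg (fun r => V (A r)) - avg V‖} : Finset (Fin b → Fin N))) :
        Set (Fin b → Fin N)) := by simp
  rw [hset, pi_uniform_apply]
  refine ENNReal.ofReal_le_ofReal ?_
  rw [div_le_iff₀ (by positivity)]
  refine h.trans (mul_le_mul_of_nonneg_right ?_ (by positivity))
  have : Real.exp (-(⌈l⌉₊ : ℝ)) ≤ δ / (m + n) := by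
    calc _ ≤ Real.exp (-l) := Real.exp_le_exp.2 (neg_le_neg (Nat.le_ceil l))
      _ = _ := by rw [Real.exp_neg, hl', Real.exp_log (by positivity), inv_div]
  calc _ ≤ (m + n) * (δ / (m + n)) := by gcongr
    _ = δ := by field_simp

/-- A vector as a linear map on the line. -/
noncomputable def lineMap : E m →ₗ[ℝ] Jac 1 m where
  toFun u := (EuclideanSpace.proj (0 : Fin 1) : E 1 →L[ℝ] ℝ).smulRight u
  map_add' u v := by ext; simp
  map_smul' c u := by ext; simp [mul_left_comm]

lemma norm_lineMap (u : E m) : ‖lineMap u‖ = ‖u‖ := by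
  refine le_antisymm (ContinuousLinearMap.opNorm_le_bound _ (norm_nonneg _) fun v => ?_) ?_
  · change ‖v 0 • u‖ ≤ _
    rw [norm_smul, mul_comm]
    gcongr
    exact PiLp.norm_apply_le v 0
  · have := (lineMap u).le_opNorm (EuclideanSpace.single 0 1)
    have h2 : (lineMap u) (EuclideanSpace.single 0 1) = u := by
      change (EuclideanSpace.single (0 : Fin 1) (1 : ℝ)) 0 • u = u
      simp
    rw [h2] at this
    simpa using this

/-- Vectors are maps from the line with the same norm, so this is the matrix bound with `n = 1`;
hence the dimension factor `m + 1`. -/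
lemma measure_vector_deviation_le [NeZero N] (V : Fin N → E m) {R κ δ : ℝ}
    (hV : ∀ j, ‖V j‖ ≤ R) (hκ : 0 < κ) (hδ : 0 < δ) (hl : 1 ≤ Real.log ((m + 1) / δ))
    (hb : 8 * Real.exp 1 * Real.log ((m + 1) / δ) ≤ b * κ ^ 2) :
    (Measure.pi fun _ : Fin b => (PMF.uniformOfFintype (Fin N)).toMeasure)
      {A | κ * R < ‖avg (fun r => V (A r)) - avg V‖} ≤ ENNReal.ofReal δ := by
  have := measure_deviation_le (b := b) (n := 1) (fun j => lineMap (V j))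
    (fun j => (norm_lineMap _).trans_le (hV j)) hκ hδ (by simpa using hl) (by simpa using hb)
  simpa only [← map_avg, ← map_sub, norm_lineMap] using this

end Sampling

/-! ### One inexact prox-linear step -/

namespace Problem

variable {n m N : ℕ} {P : Problem n m N} {lf lg Lg lhat Lhat : ℝ≥0} {M : ℝ}

/-- The objective as a real number; meaningful where `h` is finite. -/
noncomputable def realObj (P : Problem n m N) (x : E n) : ℝ := P.f (P.g x) + (P.h x).toReal

lemma Standing.coe_toReal_h (hP : P.Standing lf lg Lg lhat Lhat) {x : E n} (hx : P.h x ≠ ⊤) :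
    ((P.h x).toReal : EReal) = P.h x := EReal.coe_toReal hx (hP.h_ne_bot x)

lemma Standing.obj_eq (hP : P.Standing lf lg Lg lhat Lhat) {x : E n} (hx : P.h x ≠ ⊤) :
    P.obj x = (P.realObj x : EReal) := by
  rw [obj, realObj, EReal.coe_add, hP.coe_toReal_h hx]

lemma Standing.model_eq (hP : P.Standing lf lg Lg lhat Lhat) {y : E n} (hy : P.h y ≠ ⊤)
    (u : E m) (J : Jac n m) (c : E n) :
    P.model M u J c y =
      ((P.f (u + J (y - c)) + (P.h y).toReal + M / 2 * ‖y - c‖ ^ 2 : ℝ) : EReal) := by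
  rw [model, EReal.coe_add, EReal.coe_add, hP.coe_toReal_h hy]

lemma model_eq_top {y : E n} (hy : P.h y = ⊤) (u : E m) (J : Jac n m) (c : E n) :
    P.model M u J c y = ⊤ := by
  rw [model, hy, EReal.coe_add_top, EReal.top_add_coe]

lemma Standing.differentiable_g (hP : P.Standing lf lg Lg lhat Lhat) : Differentiable ℝ P.g := by
  unfold Problem.g avg
  exact (Differentiable.fun_sum fun j _ => hP.comp_differentiable j).const_smul (N : ℝ)⁻¹

lemma Standing.fderiv_g (hP : P.Standing lf lg Lg lhat Lhat) (x : E n) :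
    fderiv ℝ P.g x = avg fun j => fderiv ℝ (P.comp j) x := by
  have h : HasFDerivAt P.g (avg fun j => fderiv ℝ (P.comp j) x) x := by
    unfold Problem.g avg
    exact (HasFDerivAt.fun_sum fun j _ =>
      (hP.comp_differentiable j x).hasFDerivAt).const_smul (N : ℝ)⁻¹
  exact h.fderiv

/-- The mean value inequality on the segment gives the constant `Lg` rather than `Lg / 2`; this
suffices because `5 l_f L_g < M`. -/
lemma Standing.norm_linearization_le (hP : P.Standing lf lg Lg lhat Lhat) (x y : E n) :
    ‖P.g y - (P.g x + fderiv ℝ P.g x (y - x))‖ ≤ Lg * ‖y - x‖ ^ 2 := by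
  have h := (convex_segment x y).norm_image_sub_le_of_norm_fderiv_le' (𝕜 := ℝ) (f := P.g)
    (φ := fderiv ℝ P.g x) (C := Lg * ‖y - x‖) (fun z _ => hP.differentiable_g z)
    (fun z hz => by
      rw [← dist_eq_norm]
      refine (hP.jac_lipschitz.dist_le_mul z x).trans ?_
      gcongr
      rw [dist_eq_norm]
      obtain ⟨t, ht, rfl⟩ := (segment_eq_image' ℝ x y ▸ hz)
      rw [add_sub_cancel_left, norm_smul, Real.norm_of_nonneg ht.1]
      exact mul_le_of_le_one_left (norm_nonneg _) ht.2)
    (left_mem_segment ℝ x y) (right_mem_segment ℝ x y)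
  rw [← sub_sub]
  refine h.trans_eq ?_
  ring

lemma Standing.f_sub_le (hP : P.Standing lf lg Lg lhat Lhat) (u v : E m) :
    P.f u ≤ P.f v + lf * ‖u - v‖ := by
  have := (le_abs_self _).trans ((Real.dist_eq _ _ ▸ hP.f_lipschitz.dist_le_mul u v :))
  rw [dist_eq_norm] at this
  linarith

lemma Standing.f_g_le (hP : P.Standing lf lg Lg lhat Lhat) (hM : 5 * (lf : ℝ) * Lg < M)
    (x y : E n) :
    P.f (P.g y) ≤ P.f (P.g x + fderiv ℝ P.g x (y - x)) + M / 5 * ‖y - x‖ ^ 2 := by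
  have h1 := hP.f_sub_le (P.g y) (P.g x + fderiv ℝ P.g x (y - x))
  have h2 := mul_le_mul_of_nonneg_left (hP.norm_linearization_le x y) lf.2
  have h3 : (lf : ℝ) * Lg * ‖y - x‖ ^ 2 ≤ M / 5 * ‖y - x‖ ^ 2 := by
    gcongr; linarith
  have h2' : (lf : ℝ) * ‖P.g y - (P.g x + fderiv ℝ P.g x (y - x))‖ ≤ lf * (Lg * ‖y - x‖ ^ 2) := h2
  linarith

lemma Standing.lowerSemicontinuous_model (hP : P.Standing lf lg Lg lhat Lhat)
    (u : E m) (J : Jac n m) (c : E n) : LowerSemicontinuous (P.model M u J c) := by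
  have hf : Continuous P.f := hP.f_lipschitz.continuous
  have h1 : Continuous fun y => (P.f (u + J (y - c)) : EReal) :=
    continuous_coe_real_ereal.comp (by fun_prop)
  have h2 : Continuous fun y => ((M / 2 * ‖y - c‖ ^ 2 : ℝ) : EReal) :=
    continuous_coe_real_ereal.comp (by fun_prop)
  unfold model
  refine (h1.lowerSemicontinuous.add' hP.h_closed fun y => ?_).add' h2.lowerSemicontinuous
    fun y => ?_
  · exact EReal.continuousAt_add (Or.inl (EReal.coe_ne_top _)) (Or.inl (EReal.coe_ne_bot _))
  · exact EReal.continuousAt_add (Or.inr (EReal.coe_ne_bot _)) (Or.inr (EReal.coe_ne_top _))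

/-- The model dominates `Φ + (3M/10)‖y - x‖²`, as `M/2 - M/5 = 3M/10`, hence is coercive when `Φ` is
bounded below; lower semicontinuity does the rest. Existence is what gives `proxPoint` its meaning.
-/
lemma Standing.exists_isMinOn_model (hP : P.Standing lf lg Lg lhat Lhat)
    (hM : 5 * (lf : ℝ) * Lg < M) {φ : ℝ} (hφ : ∀ y, (φ : EReal) ≤ P.obj y) (x : E n) :
    ∃ y, IsMinOn (P.model M (P.g x) (fderiv ℝ P.g x) x) univ y := by
  have hM0 : 0 < M := lt_of_le_of_lt (by positivity) hM
  obtain ⟨y₀, hy₀⟩ := hP.h_proper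
  set s := P.model M (P.g x) (fderiv ℝ P.g x) x with hs
  set F : E n → ℝ := fun y =>
    P.f (P.g x + fderiv ℝ P.g x (y - x)) + (P.h y).toReal + M / 2 * ‖y - x‖ ^ 2 with hF
  have hsF : ∀ y, P.h y ≠ ⊤ → s y = (F y : EReal) := fun y hy => hP.model_eq hy _ _ _
  have hlow : ∀ y, P.h y ≠ ⊤ → φ + 3 * M / 10 * ‖y - x‖ ^ 2 ≤ F y := by
    intro y hy
    have h1 := hφ y
    rw [hP.obj_eq hy, EReal.coe_le_coe_iff, realObj] at h1
    have h2 := hP.f_g_le hM x y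
    simp only [hF]; linarith
  -- Outside this ball the lower bound `hlow` is already at least `F y₀`, and `y₀` itself lies
  -- inside.
  set r := max ‖y₀ - x‖ (Real.sqrt (10 / (3 * M) * (F y₀ - φ))) with hr
  obtain ⟨y, -, hy⟩ := (LowerSemicontinuous.lowerSemicontinuousOn
      (hP.lowerSemicontinuous_model (M := M) (P.g x) (fderiv ℝ P.g x) x)
      (Metric.closedBall x r)).exists_isMinOn ⟨y₀, by simp [hr, dist_eq_norm]⟩
      (isCompact_closedBall x r)
  refine ⟨y, fun z _ => ?_⟩
  have hyy₀ : s y ≤ s y₀ := hy (by simp [hr, dist_eq_norm])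
  by_cases hz : P.h z = ⊤
  · change s y ≤ s z
    rw [hs, model_eq_top hz]; exact le_top
  by_cases hzr : z ∈ Metric.closedBall x r
  · exact hy hzr
  · refine hyy₀.trans ?_
    rw [hsF _ hy₀, hsF _ hz, EReal.coe_le_coe_iff]
    refine le_trans ?_ (hlow z hz)
    have h1 : Real.sqrt (10 / (3 * M) * (F y₀ - φ)) ≤ ‖z - x‖ := by
      rw [Metric.mem_closedBall, dist_eq_norm, not_le] at hzr
      exact (le_max_right _ _).trans hzr.le
    have h2 := (Real.sqrt_le_left (norm_nonneg _)).1 h1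
    have h3 := mul_le_mul_of_nonneg_left h2 (by positivity : 0 ≤ 3 * M / 10)
    have h4 : 3 * M / 10 * (10 / (3 * M) * (F y₀ - φ)) = F y₀ - φ := by field_simp
    linarith

lemma Standing.h_combo_le (hP : P.Standing lf lg Lg lhat Lhat) {x y : E n} (hx : P.h x ≠ ⊤)
    (hy : P.h y ≠ ⊤) {t : ℝ} (h0 : 0 ≤ t) (h1 : t ≤ 1) :
    P.h ((1 - t) • y + t • x) ≤
      (((1 - t) * (P.h y).toReal + t * (P.h x).toReal : ℝ) : EReal) :=
  hP.h_convex (x := (y, (P.h y).toReal)) (hP.coe_toReal_h hy).symm.le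
    (y := (x, (P.h x).toReal)) (hP.coe_toReal_h hx).symm.le (sub_nonneg.2 h1) h0 (by ring)

/-- Strong convexity of the prox-linear model at its minimizer. -/
lemma Standing.isMinOn_model_le (hP : P.Standing lf lg Lg lhat Lhat)
    {x y : E n} (hx : P.h x ≠ ⊤) {u : E m} {J : Jac n m} (hy : IsMinOn (P.model M u J x) univ y) :
    P.h y ≠ ⊤ ∧ P.f (u + J (y - x)) + (P.h y).toReal + M * ‖y - x‖ ^ 2 ≤
      P.f u + (P.h x).toReal := by
  have hyx : P.model M u J x y ≤ P.model M u J x x := hy (mem_univ x)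
  have hytop : P.h y ≠ ⊤ := by
    intro h
    rw [model_eq_top h, hP.model_eq hx] at hyx
    exact absurd hyx (not_le.2 (EReal.coe_lt_top _))
  refine ⟨hytop, ?_⟩
  set F := P.f (u + J (y - x)) + (P.h y).toReal with hF
  set d := ‖y - x‖ ^ 2 with hd
  have hd0 : 0 ≤ d := sq_nonneg _
  set G := P.f u + (P.h x).toReal with hG
  -- Compare `y` with the point at fraction `t` of the way to `x`, use `1 - (1-t)² = 2t - t²`, and
  -- divide by `t`; then `t → 0`.
  have key : ∀ t : ℝ, 0 < t → t ≤ 1 → F + M * d ≤ G + t * (M / 2 * d) := by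
    intro t ht0 ht1
    set z := (1 - t) • y + t • x with hz
    have hzx : z - x = (1 - t) • (y - x) := by rw [hz]; module
    have hzh := hP.h_combo_le hx hytop ht0.le ht1
    rw [← hz] at hzh
    have hztop : P.h z ≠ ⊤ := fun h => absurd (h ▸ hzh) (not_le.2 (EReal.coe_lt_top _))
    rw [← hP.coe_toReal_h hztop, EReal.coe_le_coe_iff] at hzh
    have hyz : P.model M u J x y ≤ P.model M u J x z := hy (mem_univ z)
    rw [hP.model_eq hytop, hP.model_eq hztop, EReal.coe_le_coe_iff, hzx, norm_smul, mul_pow,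
      Real.norm_eq_abs, sq_abs, map_smul, ← hd] at hyz
    have hf := hP.f_convex.2 (mem_univ (u + J (y - x))) (mem_univ u) (sub_nonneg.2 ht1) ht0.le
      (by ring)
    have he : (1 - t) • (u + J (y - x)) + t • u = u + (1 - t) • J (y - x) := by module
    rw [he, smul_eq_mul, smul_eq_mul] at hf
    have h1 : F + M / 2 * d ≤ (1 - t) * F + t * G + M / 2 * ((1 - t) ^ 2 * d) := by
      simp only [hF, hG]; linarith
    have h2 : t * (F + M * d) ≤ t * (G + t * (M / 2 * d)) := by linarith
    exact le_of_mul_le_mul_left h2 ht0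
  have hlim : Filter.Tendsto (fun t : ℝ => G + t * (M / 2 * d)) (nhdsWithin 0 (Ioi 0))
      (nhds (G + 0 * (M / 2 * d))) :=
    ((continuous_const.add (continuous_id.mul continuous_const)).tendsto 0).mono_left
      nhdsWithin_le_nhds
  have := ge_of_tendsto hlim (by
    filter_upwards [Ioc_mem_nhdsGT (zero_lt_one' ℝ)] with t ht using key t ht.1 ht.2)
  simpa using this

/-- Sufficient decrease of an approximate step computed from approximate data. -/
lemma Standing.descent (hP : P.Standing lf lg Lg lhat Lhat) (hM : 5 * (lf : ℝ) * Lg < M) {φ : ℝ}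
    (hφ : ∀ y, (φ : EReal) ≤ P.obj y) {x xh : E n} (hx : P.h x ≠ ⊤) {u : E m} {J : Jac n m}
    {eg eJ εbar : ℝ} (hu : ‖u - P.g x‖ ≤ eg) (hJ : ‖J - fderiv ℝ P.g x‖ ≤ eJ)
    (hxh : P.model M u J x xh ≤ (⨅ y, P.model M u J x y) + (εbar : EReal)) :
    P.h xh ≠ ⊤ ∧ P.realObj xh + M / 2 * ‖P.proxPoint M x - x‖ ^ 2 + 3 * M / 10 * ‖xh - x‖ ^ 2 ≤
      P.realObj x + 2 * (lf * eg) + lf * eJ * (‖xh - x‖ + ‖P.proxPoint M x - x‖) + εbar := by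
  have hp : IsMinOn (P.model M (P.g x) (fderiv ℝ P.g x) x) univ (P.proxPoint M x) :=
    Classical.epsilon_spec (hP.exists_isMinOn_model hM hφ x)
  set p := P.proxPoint M x with hpdef
  obtain ⟨hptop, hpx⟩ := hP.isMinOn_model_le hx hp
  -- The exact prox point serves as competitor in the approximate model, so no bound on `‖xh - p‖`
  -- is needed. The data error enters twice, at `xh` and at `p`.
  have hxp : P.model M u J x xh ≤ P.model M u J x p + (εbar : EReal) :=
    hxh.trans (add_le_add_left (iInf_le _ p) _)
  rw [hP.model_eq hptop, ← EReal.coe_add] at hxp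
  have hxhtop : P.h xh ≠ ⊤ := by
    intro h
    rw [model_eq_top h] at hxp
    exact absurd hxp (not_le.2 (EReal.coe_lt_top _))
  refine ⟨hxhtop, ?_⟩
  rw [hP.model_eq hxhtop, EReal.coe_le_coe_iff] at hxp
  have hlf : (0 : ℝ) ≤ lf := lf.2
  have hlin : ∀ y : E n, (lf : ℝ) * ‖(u + J (y - x)) - (P.g x + fderiv ℝ P.g x (y - x))‖ ≤
      lf * (eg + eJ * ‖y - x‖) := by
    intro y
    refine mul_le_mul_of_nonneg_left ?_ hlf
    have : (u + J (y - x)) - (P.g x + fderiv ℝ P.g x (y - x)) =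
        (u - P.g x) + (J - fderiv ℝ P.g x) (y - x) := by
      rw [sub_apply]; abel
    rw [this]
    exact (norm_add_le _ _).trans (add_le_add hu (ContinuousLinearMap.le_of_opNorm_le _ hJ _))
  have h1 := hP.f_g_le hM x xh
  have h2 := hP.f_sub_le (P.g x + fderiv ℝ P.g x (xh - x)) (u + J (xh - x))
  rw [norm_sub_rev] at h2
  have h3 := hP.f_sub_le (u + J (p - x)) (P.g x + fderiv ℝ P.g x (p - x))
  have h4 := hlin xh
  have h5 := hlin p
  simp only [realObj]
  linarith

end Problem

/-! ### Accurate runs -/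

section Run

variable {n m N a b : ℕ} {S : Type*} {P : Problem n m N} {lf lg Lg lhat Lhat : ℝ≥0} {M : ℝ}
  {solver : Solver n S} {εbar δbar : ℝ}

/-- The pair of estimates at the inner iterate `x` of an epoch that starts at `x₀`. -/
noncomputable def estimateAt (P : Problem n m N) (i : ℕ) (x₀ x : E n) (A : Fin a → Fin N) (B : Fin b → Fin N) :
    E m × Jac n m :=
  (estimate P (snapshot P x₀).val i x A B).val

/-- One inner iteration, from the epoch's first point `x₀` and the current point `x`. -/
noncomputable def innerStep (P : Problem n m N) (M : ℝ) (solver : Solver n S) (εbar δbar : ℝ) (i : ℕ)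
    (x₀ x : E n) (z : Noise N a b S) : E n :=
  solver (P.model M (estimateAt P i x₀ x z.1 z.2.1).1 (estimateAt P i x₀ x z.1 z.2.1).2 x)
    εbar δbar z.2.2

lemma iterate_succ (τ : ℕ) (x₀ : E n) (ω : ℕ × ℕ → Noise N a b S) (k i : ℕ) :
    iterate P M solver εbar δbar τ x₀ ω k (i + 1) =
      innerStep P M solver εbar δbar i (iterate P M solver εbar δbar τ x₀ ω k 0)
        (iterate P M solver εbar δbar τ x₀ ω k i) (ω (k, i)) := rfl

lemma iterate_epoch_succ (τ : ℕ) (x₀ : E n) (ω : ℕ × ℕ → Noise N a b S) (k : ℕ) :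
    iterate P M solver εbar δbar τ x₀ ω (k + 1) 0 =
      iterate P M solver εbar δbar τ x₀ ω k τ := rfl

lemma iterate_zero_zero (τ : ℕ) (x₀ : E n) (ω : ℕ × ℕ → Noise N a b S) :
    iterate P M solver εbar δbar τ x₀ ω 0 0 = x₀ := rfl

lemma innerStep_eq (i : ℕ) (x₀ x : E n) (z : Noise N a b S) :
    innerStep P M solver εbar δbar i x₀ x z =
      solver (P.model M (estimateAt P i x₀ x z.1 z.2.1).1 (estimateAt P i x₀ x z.1 z.2.1).2 x)
        εbar δbar z.2.2 := rfl

lemma estimateAt_zero (x₀ x : E n) (A : Fin a → Fin N) (B : Fin b → Fin N) :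
    estimateAt P 0 x₀ x A B = (P.g x₀, avg fun j => fderiv ℝ (P.comp j) x₀) := rfl

lemma estimateAt_of_ne_zero {i : ℕ} (hi : i ≠ 0) (x₀ x : E n) (A : Fin a → Fin N)
    (B : Fin b → Fin N) :
    estimateAt P i x₀ x A B =
      (avg (fun r => P.comp (A r) x - P.comp (A r) x₀) + P.g x₀,
        avg (fun r => fderiv ℝ (P.comp (B r)) x - fderiv ℝ (P.comp (B r)) x₀) +
          avg fun j => fderiv ℝ (P.comp j) x₀) := by
  rw [estimateAt, estimate, if_neg hi]; rfl

/-- An inner iteration in which the estimates are accurate and the solver succeeds. -/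
structure StepAccurate (P : Problem n m N) (M : ℝ) (solver : Solver n S) (εbar δbar cg cJ : ℝ)
    (i : ℕ) (x₀ x : E n) (z : Noise N a b S) : Prop where
  value : ‖(estimateAt P i x₀ x z.1 z.2.1).1 - P.g x‖ ≤ cg * ‖x - x₀‖
  jacobian : ‖(estimateAt P i x₀ x z.1 z.2.1).2 - fderiv ℝ P.g x‖ ≤ cJ * ‖x - x₀‖
  solved : P.model M (estimateAt P i x₀ x z.1 z.2.1).1 (estimateAt P i x₀ x z.1 z.2.1).2 x
      (innerStep P M solver εbar δbar i x₀ x z) ≤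
    (⨅ y, P.model M (estimateAt P i x₀ x z.1 z.2.1).1 (estimateAt P i x₀ x z.1 z.2.1).2 x y) +
      (εbar : EReal)

/-- Cauchy-Schwarz gives `D i ^ 2 ≤ τ ∑ d²`, so the drift terms `(D i / τ)²` sum to at most `∑ d²`.
Their total coefficient `M/5 + M/20 = M/4` is below `3M/10`, and `M/2 - M/20 = 9M/20` is left for
`p`. -/
lemma epoch_sum_le {τ : ℕ} (hτ : 0 < τ) (hM0 : 0 < M) {c : ℝ} {o p d D : ℕ → ℝ}
    (hD0 : ∀ i, 0 ≤ D i) (hD : ∀ i, D i ≤ ∑ l ∈ Finset.range i, d l)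
    {j : ℕ} (hj : j ≤ τ)
    (h : ∀ i < j, o (i + 1) + M / 2 * p i ^ 2 + 3 * M / 10 * d i ^ 2 ≤
      o i + M / 5 * (D i / τ) ^ 2 + M / 20 * (d i ^ 2 + p i ^ 2) + c) :
    o j + 9 * M / 20 * ∑ i ∈ Finset.range j, p i ^ 2 ≤ o 0 + j * c := by
  have hτ' : (0 : ℝ) < τ := by exact_mod_cast hτ
  have hjτ : (j : ℝ) ≤ τ := by exact_mod_cast hj
  have h1 : ∑ i ∈ Finset.range j, (D i / τ) ^ 2 ≤ ∑ l ∈ Finset.range j, d l ^ 2 := by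
    have h2 : ∀ i ∈ Finset.range j,
        (D i / τ) ^ 2 ≤ (τ : ℝ)⁻¹ * ∑ l ∈ Finset.range j, d l ^ 2 := by
      intro i hi
      have hij := Finset.mem_range.1 hi
      have hiτ : (i : ℝ) ≤ τ := by exact_mod_cast (hij.le.trans hj)
      have h3 : D i ^ 2 ≤ i * ∑ l ∈ Finset.range i, d l ^ 2 := by
        refine (pow_le_pow_left₀ (hD0 i) (hD i) 2).trans ?_
        simpa using sq_sum_le_card_mul_sum_sq (s := Finset.range i) (f := d)
      have h4 : ∑ l ∈ Finset.range i, d l ^ 2 ≤ ∑ l ∈ Finset.range j, d l ^ 2 :=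
        Finset.sum_le_sum_of_subset_of_nonneg
          (Finset.range_subset_range.2 hij.le) fun _ _ _ => sq_nonneg _
      have h5 : D i ^ 2 ≤ τ * ∑ l ∈ Finset.range j, d l ^ 2 :=
        h3.trans (mul_le_mul hiτ h4 (Finset.sum_nonneg fun _ _ => sq_nonneg _) hτ'.le)
      rw [div_pow, div_le_iff₀ (by positivity)]
      calc _ ≤ _ := h5
        _ = _ := by field_simp
    calc _ ≤ ∑ _i ∈ Finset.range j, (τ : ℝ)⁻¹ * ∑ l ∈ Finset.range j, d l ^ 2 :=
          Finset.sum_le_sum h2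
      _ = (j / τ : ℝ) * ∑ l ∈ Finset.range j, d l ^ 2 := by
          rw [Finset.sum_const, Finset.card_range, nsmul_eq_mul]; ring
      _ ≤ 1 * ∑ l ∈ Finset.range j, d l ^ 2 := by
          refine mul_le_mul_of_nonneg_right ((div_le_one hτ').2 hjτ) ?_
          exact Finset.sum_nonneg fun _ _ => sq_nonneg _
      _ = _ := one_mul _
  have h2 : ∑ i ∈ Finset.range j,
      (o (i + 1) + M / 2 * p i ^ 2 + 3 * M / 10 * d i ^ 2) ≤ ∑ i ∈ Finset.range j,
      (o i + M / 5 * (D i / τ) ^ 2 + M / 20 * (d i ^ 2 + p i ^ 2) + c) :=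
    Finset.sum_le_sum fun i hi => h i (Finset.mem_range.1 hi)
  have h3 := Finset.sum_range_sub o j
  have h4 : 0 ≤ ∑ l ∈ Finset.range j, d l ^ 2 := Finset.sum_nonneg fun _ _ => sq_nonneg _
  simp only [Finset.sum_add_distrib, Finset.sum_sub_distrib, ← Finset.mul_sum, Finset.sum_const,
    Finset.card_range, nsmul_eq_mul] at h2 h3
  have h5 := mul_le_mul_of_nonneg_left h1 hM0.le
  have h6 := mul_nonneg hM0.le h4
  linarith

lemma step_le (hP : P.Standing lf lg Lg lhat Lhat) (hM : 5 * (lf : ℝ) * Lg < M) {φ : ℝ}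
    (hφ : ∀ y, (φ : EReal) ≤ P.obj y) {τ : ℕ} {ε cg cJ : ℝ} (hε : 0 < ε)
    (hcg : lf * cg ≤ Real.sqrt ε / (100 * τ)) (hcJ : lf * cJ ≤ M / (10 * τ)) {i : ℕ}
    {x₀ x : E n} {z : Noise N a b S} (hx : P.h x ≠ ⊤)
    (hz : StepAccurate P M solver εbar δbar cg cJ i x₀ x z) :
    P.h (innerStep P M solver εbar δbar i x₀ x z) ≠ ⊤ ∧
    P.realObj (innerStep P M solver εbar δbar i x₀ x z) +
      M / 2 * ‖P.proxPoint M x - x‖ ^ 2 +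
      3 * M / 10 * ‖innerStep P M solver εbar δbar i x₀ x z - x‖ ^ 2 ≤
    P.realObj x + M / 5 * (‖x - x₀‖ / τ) ^ 2 +
      M / 20 * (‖innerStep P M solver εbar δbar i x₀ x z - x‖ ^ 2 +
        ‖P.proxPoint M x - x‖ ^ 2) + (ε / (1000 * M) + εbar) := by
  have hM0 : 0 < M := lt_of_le_of_lt (by positivity) hM
  obtain ⟨h1, h2⟩ := hP.descent hM hφ hx hz.value hz.jacobian hz.solved
  refine ⟨h1, ?_⟩
  set d := ‖innerStep P M solver εbar δbar i x₀ x z - x‖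
  set p := ‖P.proxPoint M x - x‖
  set w := ‖x - x₀‖ / τ with hw
  have hw0 : 0 ≤ w := by positivity
  have hd0 : 0 ≤ d := norm_nonneg _
  have hp0 : 0 ≤ p := norm_nonneg _
  have h3 : lf * (cg * ‖x - x₀‖) ≤ Real.sqrt ε / 100 * w := by
    calc _ = lf * cg * ‖x - x₀‖ := by ring
      _ ≤ Real.sqrt ε / (100 * τ) * ‖x - x₀‖ := by gcongr
      _ = _ := by rw [hw]; field_simp
  have h4 : lf * (cJ * ‖x - x₀‖) * (d + p) ≤ M / 10 * w * (d + p) := by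
    have : lf * (cJ * ‖x - x₀‖) ≤ M / 10 * w := by
      calc _ = lf * cJ * ‖x - x₀‖ := by ring
        _ ≤ M / (10 * τ) * ‖x - x₀‖ := by gcongr
        _ = _ := by rw [hw]; field_simp
    gcongr
  -- Young's inequality for the Jacobian error here and for the value error next; each contributes
  -- `M / 10 * w ^ 2`, which makes up the `M / 5`.
  have h5 : M / 10 * w * (d + p) ≤ M / 10 * w ^ 2 + M / 20 * (d ^ 2 + p ^ 2) := by
    nlinarith [mul_nonneg hM0.le (sq_nonneg (w - d)), mul_nonneg hM0.le (sq_nonneg (w - p))]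
  have h6 : 2 * (Real.sqrt ε / 100 * w) ≤ M / 10 * w ^ 2 + ε / (1000 * M) := by
    have h7 : ε / (1000 * M) = M / 10 * (Real.sqrt ε / (10 * M)) ^ 2 := by
      rw [div_pow, Real.sq_sqrt hε.le]; field_simp; norm_num
    have h8 : Real.sqrt ε / 100 * w = M / 10 * (w * (Real.sqrt ε / (10 * M))) := by
      field_simp; ring
    rw [h7, h8]
    nlinarith [mul_nonneg hM0.le (sq_nonneg (w - Real.sqrt ε / (10 * M)))]
  linarith

/-- Finiteness of `h` is carried through the induction because `realObj` is meaningful only where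
`h` is finite. -/
lemma run_sum_le (hP : P.Standing lf lg Lg lhat Lhat) (hM : 5 * (lf : ℝ) * Lg < M) {φ : ℝ}
    (hφ : ∀ y, (φ : EReal) ≤ P.obj y) {τ : ℕ} (hτ : 0 < τ) {ε cg cJ : ℝ} (hε : 0 < ε)
    (hcg : lf * cg ≤ Real.sqrt ε / (100 * τ)) (hcJ : lf * cJ ≤ M / (10 * τ))
    {x₀ : E n} (hx₀ : P.h x₀ ≠ ⊤) {ω : ℕ × ℕ → Noise N a b S} {K : ℕ}
    (hω : ∀ k < K, ∀ i < τ, StepAccurate P M solver εbar δbar cg cJ i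
      (iterate P M solver εbar δbar τ x₀ ω k 0) (iterate P M solver εbar δbar τ x₀ ω k i)
      (ω (k, i))) :
    P.h (iterate P M solver εbar δbar τ x₀ ω K 0) ≠ ⊤ ∧
    P.realObj (iterate P M solver εbar δbar τ x₀ ω K 0) + 9 * M / 20 *
      ∑ k ∈ Finset.range K, ∑ i ∈ Finset.range τ,
        ‖P.proxPoint M (iterate P M solver εbar δbar τ x₀ ω k i) -
          iterate P M solver εbar δbar τ x₀ ω k i‖ ^ 2 ≤
      P.realObj x₀ + K * (τ * (ε / (1000 * M) + εbar)) := by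
  have hM0 : 0 < M := lt_of_le_of_lt (by positivity) hM
  induction K with
  | zero => simpa [iterate_zero_zero] using hx₀
  | succ K ih =>
    obtain ⟨hK, ihK⟩ := ih fun k hk => hω k (hk.trans K.lt_succ_self)
    set x := iterate P M solver εbar δbar τ x₀ ω K with hxdef
    have hfin : ∀ i ≤ τ, P.h (x i) ≠ ⊤ := by
      intro i
      induction i with
      | zero => exact fun _ => hK
      | succ i ihi =>
        exact fun hi => (step_le hP hM hφ hε hcg hcJ (ihi (by omega))
          (hω K K.lt_succ_self i (by omega))).1
    have hE := epoch_sum_le (o := fun i => P.realObj (x i))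
      (p := fun i => ‖P.proxPoint M (x i) - x i‖) (d := fun i => ‖x (i + 1) - x i‖)
      (D := fun i => ‖x i - x 0‖) hτ hM0 (fun i => norm_nonneg _)
      (fun i => by rw [← Finset.sum_range_sub x i]; exact norm_sum_le _ _) (le_refl τ)
      (fun i hi => (step_le hP hM hφ hε hcg hcJ (hfin i hi.le)
        (hω K K.lt_succ_self i hi)).2)
    refine ⟨hfin τ le_rfl, ?_⟩
    rw [Finset.sum_range_succ, iterate_epoch_succ, ← hxdef, mul_add]
    push_cast
    linarith

lemma average_genGrad_le (hP : P.Standing lf lg Lg lhat Lhat) (hM : 5 * (lf : ℝ) * Lg < M)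
    {φ D : ℝ} (hφ : ∀ y, (φ : EReal) ≤ P.obj y) {τ : ℕ} (hτ : 0 < τ) {ε cg cJ : ℝ} (hε : 0 < ε)
    (hcg : lf * cg ≤ Real.sqrt ε / (100 * τ)) (hcJ : lf * cJ ≤ M / (10 * τ))
    {x₀ : E n} (hx₀ : P.h x₀ ≠ ⊤) (hD : P.realObj x₀ ≤ φ + D)
    {ω : ℕ × ℕ → Noise N a b S} {K : ℕ} (hK : 0 < K) (hKD : 5 * M * D ≤ K * τ * ε)
    (hεbar : εbar = ε / (5 * 30 * M))
    (hω : ∀ k < K, ∀ i < τ, StepAccurate P M solver εbar δbar cg cJ i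
      (iterate P M solver εbar δbar τ x₀ ω k 0) (iterate P M solver εbar δbar τ x₀ ω k i)
      (ω (k, i))) :
    1 / ((K : ℝ) * τ) * ∑ k ∈ Finset.range K, ∑ i ∈ Finset.range τ,
      ‖P.genGrad M (iterate P M solver εbar δbar τ x₀ ω k i)‖ ^ 2 ≤ ε := by
  have hM0 : 0 < M := lt_of_le_of_lt (by positivity) hM
  have hτ' : (0 : ℝ) < τ := by exact_mod_cast hτ
  have hK' : (0 : ℝ) < K := by exact_mod_cast hK
  obtain ⟨h1, h2⟩ := run_sum_le hP hM hφ hτ hε hcg hcJ hx₀ hω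
  have h3 := hφ (iterate P M solver εbar δbar τ x₀ ω K 0)
  rw [hP.obj_eq h1, EReal.coe_le_coe_iff] at h3
  have hgen : ∀ y, ‖P.genGrad M y‖ ^ 2 = M ^ 2 * ‖P.proxPoint M y - y‖ ^ 2 := by
    intro y
    rw [Problem.genGrad, norm_smul, mul_pow, Real.norm_eq_abs, sq_abs, norm_sub_rev]
  simp only [hgen, ← Finset.mul_sum]
  set T := ∑ k ∈ Finset.range K, ∑ i ∈ Finset.range τ,
        ‖P.proxPoint M (iterate P M solver εbar δbar τ x₀ ω k i) -
          iterate P M solver εbar δbar τ x₀ ω k i‖ ^ 2 with hT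
  rw [one_div_mul_eq_div, div_le_iff₀ (by positivity)]
  have h4 : 9 * M / 20 * T ≤ D + K * (τ * (ε / (1000 * M) + εbar)) := by linarith
  have h5 := mul_le_mul_of_nonneg_left h4 hM0.le
  -- Since `M D ≤ Kτε / 5`, the claim comes down to `1/5 + 1/1000 + 1/150 ≤ 9/20`.
  have h6 : M * (D + K * (τ * (ε / (1000 * M) + εbar))) =
      M * D + (K * τ * ε) * (1 / 1000 + 1 / 150) := by
    rw [hεbar]; field_simp; ring
  have h7 : 0 < K * τ * ε := by positivity
  have h8 : M * (9 * M / 20 * T) = 9 / 20 * (M ^ 2 * T) := by ring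
  rw [h6, h8] at h5
  linarith

end Run

/-! ### Numbers of oracle calls -/

section Counting

variable {n m N a b : ℕ} {S : Type*} (P : Problem n m N) (M : ℝ)
  (solver : Solver n S) (εbar δbar : ℝ)

lemma snapshot_evals (x : E n) : (snapshot P x).evals = N := by
  change (∑ _j : Fin N, 1) + ((∑ _j : Fin N, 0) + 0) = N
  simp

lemma snapshot_jacs (x : E n) : (snapshot P x).jacs = N := by
  change (∑ _j : Fin N, 0) + ((∑ _j : Fin N, 1) + 0) = N
  simp

lemma estimate_evals_le (mem : Memory n m N) (i : ℕ) (x : E n) (A : Fin a → Fin N)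
    (B : Fin b → Fin N) : (estimate P mem i x A B).evals ≤ a := by
  unfold estimate
  split_ifs
  · exact Nat.zero_le _
  · change (∑ _r : Fin a, 1) + ((∑ _r : Fin b, 0) + 0) ≤ a
    simp

lemma estimate_jacs_le (mem : Memory n m N) (i : ℕ) (x : E n) (A : Fin a → Fin N)
    (B : Fin b → Fin N) : (estimate P mem i x A B).jacs ≤ b := by
  unfold estimate
  split_ifs
  · exact Nat.zero_le _
  · change (∑ _r : Fin a, 0) + ((∑ _r : Fin b, 1) + 0) ≤ b
    simp

lemma innerLoop_evals_le (mem : Memory n m N) (x₀ : E n) (z : ℕ → Noise N a b S) (i : ℕ) :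
    (innerLoop P M solver εbar δbar mem x₀ z i).evals ≤ i * a := by
  induction i with
  | zero => exact Nat.zero_le _
  | succ i ih =>
    change (innerLoop P M solver εbar δbar mem x₀ z i).evals +
      ((estimate P mem i (innerLoop P M solver εbar δbar mem x₀ z i).val
        (z i).1 (z i).2.1).evals + 0) ≤ _
    have := estimate_evals_le P mem i (innerLoop P M solver εbar δbar mem x₀ z i).val
        (z i).1 (z i).2.1
    rw [Nat.succ_mul]
    omega

lemma innerLoop_jacs_le (mem : Memory n m N) (x₀ : E n) (z : ℕ → Noise N a b S) (i : ℕ) :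
    (innerLoop P M solver εbar δbar mem x₀ z i).jacs ≤ i * b := by
  induction i with
  | zero => exact Nat.zero_le _
  | succ i ih =>
    change (innerLoop P M solver εbar δbar mem x₀ z i).jacs +
      ((estimate P mem i (innerLoop P M solver εbar δbar mem x₀ z i).val
        (z i).1 (z i).2.1).jacs + 0) ≤ _
    have := estimate_jacs_le P mem i (innerLoop P M solver εbar δbar mem x₀ z i).val
        (z i).1 (z i).2.1
    rw [Nat.succ_mul]
    omega

lemma method_evals_le (τ : ℕ) (x₀ : E n) (ω : ℕ × ℕ → Noise N a b S) (K : ℕ) :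
    (method P M solver εbar δbar τ x₀ ω K).evals ≤ K * (N + τ * a) := by
  induction K with
  | zero => exact Nat.zero_le _
  | succ K ih =>
    set x := (method P M solver εbar δbar τ x₀ ω K).val with hx
    change (method P M solver εbar δbar τ x₀ ω K).evals + ((snapshot P x).evals +
      (innerLoop P M solver εbar δbar (snapshot P x).val x (fun i => ω (K, i)) τ).evals) ≤ _
    have := innerLoop_evals_le P M solver εbar δbar (snapshot P x).val x (fun i => ω (K, i)) τ
    rw [snapshot_evals, Nat.succ_mul]
    omega

lemma method_jacs_le (τ : ℕ) (x₀ : E n) (ω : ℕ × ℕ → Noise N a b S) (K : ℕ) :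
    (method P M solver εbar δbar τ x₀ ω K).jacs ≤ K * (N + τ * b) := by
  induction K with
  | zero => exact Nat.zero_le _
  | succ K ih =>
    set x := (method P M solver εbar δbar τ x₀ ω K).val with hx
    change (method P M solver εbar δbar τ x₀ ω K).jacs + ((snapshot P x).jacs +
      (innerLoop P M solver εbar δbar (snapshot P x).val x (fun i => ω (K, i)) τ).jacs) ≤ _
    have := innerLoop_jacs_le P M solver εbar δbar (snapshot P x).val x (fun i => ω (K, i)) τ
    rw [snapshot_jacs, Nat.succ_mul]
    omega

end Counting

/-! ### Probability of an accurate run -/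

section Resampling

variable {T X Y : Type*} [MeasurableSpace X] [MeasurableSpace Y]

/-- Resampling one coordinate preserves a product law. -/
lemma map_update_infinitePi [DecidableEq T] (ν : Measure X) [IsProbabilityMeasure ν] (t : T) :
    ((Measure.infinitePi fun _ : T => ν).prod ν).map
      (fun p => Function.update p.1 t p.2) = Measure.infinitePi fun _ : T => ν := by
  refine Measure.eq_infinitePi (μ := fun _ : T => ν) fun s B hB => ?_
  rw [Measure.map_apply measurable_update' (MeasurableSet.pi s.countable_toSet fun i _ => hB i)]
  by_cases ht : t ∈ s
  · have : (fun p : (T → X) × X => Function.update p.1 t p.2) ⁻¹' Set.pi s B =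
        (Set.pi (s.erase t : Finset T) B) ×ˢ B t := by
      ext ⟨w, x⟩
      simp only [mem_preimage, Set.mem_pi, Finset.mem_coe, Finset.mem_erase, mem_prod]
      constructor
      · intro h
        refine ⟨fun i hi => ?_, ?_⟩
        · have := h i hi.2; rwa [Function.update_of_ne hi.1] at this
        · have := h t ht; rwa [Function.update_self] at this
      · rintro ⟨h1, h2⟩ i hi
        by_cases hit : i = t
        · subst hit; rwa [Function.update_self]
        · rw [Function.update_of_ne hit]; exact h1 i ⟨hit, hi⟩
    rw [this, Measure.prod_prod, Measure.infinitePi_pi _ fun i _ => hB i, Finset.prod_erase_mul _ _ ht]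
  · have : (fun p : (T → X) × X => Function.update p.1 t p.2) ⁻¹' Set.pi s B =
        (Set.pi s B) ×ˢ univ := by
      ext ⟨w, x⟩
      simp only [mem_preimage, Set.mem_pi, Finset.mem_coe, mem_prod, mem_univ, and_true]
      refine forall₂_congr fun i hi => ?_
      rw [Function.update_of_ne (by rintro rfl; exact ht hi)]
    rw [this, Measure.prod_prod, Measure.infinitePi_pi _ fun i _ => hB i, measure_univ, mul_one]

lemma prod_apply_le (μ : Measure X) [IsProbabilityMeasure μ] (ν : Measure Y) [SFinite ν]
    {s : Set (X × Y)} (hs : MeasurableSet s) {c : ℝ≥0∞} (h : ∀ x, ν {y | (x, y) ∈ s} ≤ c) :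
    (μ.prod ν) s ≤ c := by
  rw [Measure.prod_apply hs]
  calc _ ≤ ∫⁻ _, c ∂μ := lintegral_mono h
    _ = c := by simp

/-- A fresh coordinate violates a condition on a state that does not depend on it with at most
the probability that it has for a fixed state. -/
lemma infinitePi_state_le [DecidableEq T] (ν : Measure X) [IsProbabilityMeasure ν] (t : T)
    {f : (T → X) → Y} (hf : Measurable f) (hft : ∀ w x, f (Function.update w t x) = f w)
    {B : Set (Y × X)} (hB : MeasurableSet B) {c : ℝ≥0∞}
    (h : ∀ w, ν {x | (f w, x) ∈ B} ≤ c) :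
    (Measure.infinitePi fun _ : T => ν) {w | (f w, w t) ∈ B} ≤ c := by
  have hm : MeasurableSet {w : T → X | (f w, w t) ∈ B} := (hf.prodMk (measurable_pi_apply t)) hB
  -- After resampling coordinate `t` the state `f w` is unchanged, so Fubini reduces to a fixed
  -- state.
  rw [← map_update_infinitePi ν t, Measure.map_apply measurable_update' hm]
  refine prod_apply_le _ _ (measurable_update' hm) fun w => ?_
  simpa [hft] using h w

end Resampling

/-! ### Measurability of the run and its dependence on past noise only -/

section Measurability

variable {n m N a b : ℕ} {S : Type*} [MeasurableSpace S] {P : Problem n m N}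
  {lf lg Lg lhat Lhat : ℝ≥0} {M : ℝ} {ν : Measure S} {solver : Solver n S} {εbar δbar : ℝ}

lemma Problem.Standing.measurable_model (hP : P.Standing lf lg Lg lhat Lhat) :
    Measurable fun p : (E m × Jac n m × E n) × E n => P.model M p.1.1 p.1.2.1 p.1.2.2 p.2 := by
  have hf : Continuous P.f := hP.f_lipschitz.continuous
  have h1 : Continuous fun p : (E m × Jac n m × E n) × E n =>
      P.f (p.1.1 + p.1.2.1 (p.2 - p.1.2.2)) := by fun_prop
  have h2 : Continuous fun p : (E m × Jac n m × E n) × E n => M / 2 * ‖p.2 - p.1.2.2‖ ^ 2 := by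
    fun_prop
  unfold Problem.model
  exact ((h1.measurable.coe_real_ereal).add (hP.h_closed.measurable.comp measurable_snd)).add
    h2.measurable.coe_real_ereal

/-- The infimum is uncountable, but for fixed `y` the model is continuous in the data or constantly
`⊤`, so the infimum is upper semicontinuous. -/
lemma Problem.Standing.measurable_iInf_model (hP : P.Standing lf lg Lg lhat Lhat) :
    Measurable fun p : E m × Jac n m × E n => ⨅ y, P.model M p.1 p.2.1 p.2.2 y := by
  refine (upperSemicontinuous_iInf fun y => ?_).measurable
  have hf : Continuous P.f := hP.f_lipschitz.continuous
  by_cases hy : P.h y = ⊤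
  · simp only [Problem.model_eq_top hy]
    exact upperSemicontinuous_const
  · simp only [hP.model_eq hy]
    refine (continuous_coe_real_ereal.comp ?_).upperSemicontinuous
    fun_prop

lemma Problem.Standing.measurable_comp (hP : P.Standing lf lg Lg lhat Lhat) :
    Measurable fun p : Fin N × E n => P.comp p.1 p.2 :=
  measurable_from_prod_countable_right fun j => (hP.comp_lipschitz j).continuous.measurable

lemma Problem.Standing.measurable_fderiv_comp (hP : P.Standing lf lg Lg lhat Lhat) :
    Measurable fun p : Fin N × E n => fderiv ℝ (P.comp p.1) p.2 :=
  measurable_from_prod_countable_right fun j => (hP.comp_jac_lipschitz j).continuous.measurable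

lemma measurable_avg {V X : Type*} [NormedAddCommGroup V] [NormedSpace ℝ V] [MeasurableSpace V]
    [BorelSpace V] [SecondCountableTopology V] [MeasurableSpace X] {r : ℕ} {v : Fin r → X → V}
    (hv : ∀ j, Measurable (v j)) : Measurable fun x => avg fun j => v j x := by
  unfold avg
  exact (Finset.measurable_sum _ fun j _ => hv j).const_smul _

lemma measurable_estimateAt (hP : P.Standing lf lg Lg lhat Lhat) (i : ℕ) :
    Measurable fun p : (E n × E n) × Noise N a b S =>
      estimateAt P i p.1.1 p.1.2 p.2.1 p.2.2.1 := by
  have hg0 : Measurable fun p : (E n × E n) × Noise N a b S => P.g p.1.1 :=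
    hP.g_lipschitz.continuous.measurable.comp (by fun_prop)
  have hJ0 : Measurable fun p : (E n × E n) × Noise N a b S =>
      avg fun j => fderiv ℝ (P.comp j) p.1.1 :=
    measurable_avg fun j => (hP.comp_jac_lipschitz j).continuous.measurable.comp (by fun_prop)
  by_cases hi : i = 0
  · subst hi
    simp only [estimateAt_zero]
    exact hg0.prodMk hJ0
  · simp only [estimateAt_of_ne_zero hi]
    have hA : ∀ r, Measurable fun p : (E n × E n) × Noise N a b S => p.2.1 r := fun r => by fun_prop
    have hB : ∀ r, Measurable fun p : (E n × E n) × Noise N a b S => p.2.2.1 r :=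
      fun r => by fun_prop
    have h1 : Measurable fun p : (E n × E n) × Noise N a b S => p.1.1 := by fun_prop
    have h2 : Measurable fun p : (E n × E n) × Noise N a b S => p.1.2 := by fun_prop
    refine ((measurable_avg fun r => ?_).add hg0).prodMk ((measurable_avg fun r => ?_).add hJ0)
    · exact (hP.measurable_comp.comp ((hA r).prodMk h2)).sub
        (hP.measurable_comp.comp ((hA r).prodMk h1))
    · exact (hP.measurable_fderiv_comp.comp ((hB r).prodMk h2)).sub
        (hP.measurable_fderiv_comp.comp ((hB r).prodMk h1))

lemma measurable_modelData (hP : P.Standing lf lg Lg lhat Lhat) (i : ℕ) :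
    Measurable fun p : (E n × E n) × Noise N a b S =>
      ((estimateAt P i p.1.1 p.1.2 p.2.1 p.2.2.1).1,
        (estimateAt P i p.1.1 p.1.2 p.2.1 p.2.2.1).2, p.1.2) := by
  have := measurable_estimateAt (a := a) (b := b) (S := S) hP i
  exact this.fst.prodMk (this.snd.prodMk (by fun_prop))

attribute [local irreducible] estimateAt innerStep iterate

lemma measurable_solver (hs : SolverGuarantee P M ν solver) (hε : 0 < εbar) (hδ : 0 < δbar)
    {X : Type*} [MeasurableSpace X] {d : X → E m × Jac n m × E n} {ζ : X → S}
    (hd : Measurable d) (hζ : Measurable ζ) :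
    Measurable fun x => solver (P.model M (d x).1 (d x).2.1 (d x).2.2) εbar δbar (ζ x) := by
  have := (hs.measurable εbar hε δbar hδ).comp (hd.prodMk hζ)
  exact this

lemma measurable_innerStep (hP : P.Standing lf lg Lg lhat Lhat)
    (hs : SolverGuarantee P M ν solver) (hε : 0 < εbar) (hδ : 0 < δbar) (i : ℕ) :
    Measurable fun p : (E n × E n) × Noise N a b S =>
      innerStep P M solver εbar δbar i p.1.1 p.1.2 p.2 := by
  simp only [innerStep_eq]
  have hd := measurable_modelData (a := a) (b := b) (S := S) hP i
  have hζ : Measurable fun p : (E n × E n) × Noise N a b S => p.2.2.2 := by fun_prop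
  have := measurable_solver hs hε hδ hd hζ
  exact this

lemma measurable_iterate (hP : P.Standing lf lg Lg lhat Lhat)
    (hs : SolverGuarantee P M ν solver) (hε : 0 < εbar) (hδ : 0 < δbar) (τ : ℕ) (x₀ : E n)
    (k i : ℕ) : Measurable fun ω : ℕ × ℕ → Noise N a b S =>
      iterate P M solver εbar δbar τ x₀ ω k i := by
  have hstep : ∀ k i, (Measurable fun ω : ℕ × ℕ → Noise N a b S =>
      iterate P M solver εbar δbar τ x₀ ω k 0) →
      Measurable fun ω : ℕ × ℕ → Noise N a b S => iterate P M solver εbar δbar τ x₀ ω k i := by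
    intro k i h0
    induction i with
    | zero => exact h0
    | succ i ih =>
      simp only [iterate_succ]
      have hω : Measurable fun ω : ℕ × ℕ → Noise N a b S => ω (k, i) := measurable_pi_apply (k, i)
      have := (measurable_innerStep (a := a) (b := b) hP hs hε hδ i).comp ((h0.prodMk ih).prodMk hω)
      exact this
  refine hstep k i ?_
  induction k with
  | zero => simp only [iterate_zero_zero]; exact measurable_const
  | succ k ih => simp only [iterate_epoch_succ]; exact hstep k τ ih

lemma measurableSet_stepAccurate (hP : P.Standing lf lg Lg lhat Lhat)
    (hs : SolverGuarantee P M ν solver) (hε : 0 < εbar) (hδ : 0 < δbar) (cg cJ : ℝ) (i : ℕ) :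
    MeasurableSet {p : (E n × E n) × Noise N a b S |
      StepAccurate P M solver εbar δbar cg cJ i p.1.1 p.1.2 p.2} := by
  have hd := measurable_modelData (a := a) (b := b) (S := S) hP i
  have hx := measurable_innerStep (a := a) (b := b) hP hs hε hδ i
  have hdist : Measurable fun p : (E n × E n) × Noise N a b S => ‖p.1.2 - p.1.1‖ := by fun_prop
  have hg : Measurable fun p : (E n × E n) × Noise N a b S => P.g p.1.2 :=
    hP.g_lipschitz.continuous.measurable.comp (by fun_prop)
  have hJ : Measurable fun p : (E n × E n) × Noise N a b S => fderiv ℝ P.g p.1.2 :=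
    hP.jac_lipschitz.continuous.measurable.comp (by fun_prop)
  have h1 := measurableSet_le (hd.fst.sub hg).norm (hdist.const_mul cg)
  have h2 := measurableSet_le (hd.snd.fst.sub hJ).norm (hdist.const_mul cJ)
  have h3 := measurableSet_le ((hP.measurable_model (M := M)).comp (hd.prodMk hx))
    (((hP.measurable_iInf_model (M := M)).comp hd).add (measurable_const (a := (εbar : EReal))))
  convert (h1.inter h2).inter h3 using 1
  ext p
  exact ⟨fun h => ⟨⟨h.1, h.2⟩, h.3⟩, fun h => ⟨h.1.1, h.1.2, h.2⟩⟩

omit [MeasurableSpace S] in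
-- Only noise lexicographically before `(k, i)` is read, so `ω (k, i)` is fresh for `xᵢᵏ`.
lemma iterate_congr (τ : ℕ) (x₀ : E n) {ω ω' : ℕ × ℕ → Noise N a b S} (k i : ℕ)
    (h : ∀ k' i', k' < k ∨ k' = k ∧ i' < i → ω (k', i') = ω' (k', i')) :
    iterate P M solver εbar δbar τ x₀ ω k i = iterate P M solver εbar δbar τ x₀ ω' k i := by
  induction k generalizing i with
  | zero =>
    induction i with
    | zero => rw [iterate_zero_zero, iterate_zero_zero]
    | succ i ih =>
      have h0 : iterate P M solver εbar δbar τ x₀ ω 0 0 =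
        iterate P M solver εbar δbar τ x₀ ω' 0 0 := by rw [iterate_zero_zero, iterate_zero_zero]
      rw [iterate_succ, iterate_succ, ih fun k' i' hk => h k' i' (by omega), h0,
        h 0 i (by omega)]
  | succ k ihk =>
    have h0 : iterate P M solver εbar δbar τ x₀ ω (k + 1) 0 =
        iterate P M solver εbar δbar τ x₀ ω' (k + 1) 0 :=
      (iterate_epoch_succ ..).trans
        ((ihk τ fun k' i' hk => h k' i' (by omega)).trans (iterate_epoch_succ ..).symm)
    induction i with
    | zero => exact h0
    | succ i ih =>
      rw [iterate_succ, iterate_succ, ih fun k' i' hk => h k' i' (by omega), h0,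
        h (k + 1) i (by omega)]

end Measurability

/-! ### Failure probability of one iteration and union bound -/

section Accuracy

variable {n m N a b : ℕ} [NeZero N] {S : Type*} [MeasurableSpace S] {P : Problem n m N}
  {lf lg Lg lhat Lhat : ℝ≥0} {M : ℝ} {ν : Measure S} [IsProbabilityMeasure ν]
  {solver : Solver n S} {εbar δbar : ℝ}

/-- The mean of a batch of `r` indices, sampled with replacement, deviates by more than `κ` times
the size of the terms with probability at most `δ`. -/
def BatchConcentrates (N r : ℕ) [NeZero N] (V : Type*) [NormedAddCommGroup V] [NormedSpace ℝ V]
    (κ δ : ℝ) : Prop :=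
  ∀ (v : Fin N → V) (R : ℝ), (∀ j, ‖v j‖ ≤ R) →
    (Measure.pi fun _ : Fin r => (PMF.uniformOfFintype (Fin N)).toMeasure)
      {A | κ * R < ‖avg (fun s => v (A s)) - avg v‖} ≤ ENNReal.ofReal δ

omit [NeZero N] in
lemma measure_solver_fails_le (hP : P.Standing lf lg Lg lhat Lhat)
    (hs : SolverGuarantee P M ν solver) (hε : 0 < εbar) (hδ : 0 < δbar)
    (u : E m) (J : Jac n m) (c : E n) :
    ν {ζ | ¬ P.model M u J c (solver (P.model M u J c) εbar δbar ζ) ≤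
        (⨅ y, P.model M u J c y) + (εbar : EReal)} ≤ ENNReal.ofReal δbar := by
  have hm : MeasurableSet {ζ | P.model M u J c (solver (P.model M u J c) εbar δbar ζ) ≤
        (⨅ y, P.model M u J c y) + (εbar : EReal)} := by
    have h1 : Measurable fun ζ => solver (P.model M u J c) εbar δbar ζ :=
      measurable_solver hs hε hδ (d := fun _ => (u, J, c)) measurable_const measurable_id
    have h2 : Measurable fun _ : S => ((u, J, c) : E m × Jac n m × E n) := measurable_const
    have h3 := (hP.measurable_model (M := M)).comp (h2.prodMk h1)
    exact measurableSet_le h3 measurable_const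
  have h := hs.near_optimal εbar hε δbar hδ u J c
  rw [← compl_ofPred, prob_compl_eq_one_sub hm]
  refine (tsub_le_tsub_left h 1).trans ?_
  rw [tsub_le_iff_right, ← ENNReal.ofReal_one, ← sub_add_cancel 1 δbar, add_comm (1 - δbar)]
  refine ENNReal.ofReal_add_le.trans ?_
  simp

/-- A failure is a deviation of the first batch, of the second batch, or of the solver. The
Lipschitz bounds on the components make the sampled terms at most `lhat * ‖x - x₀‖` and `Lhat * ‖x -
x₀‖`. -/
lemma noiseLaw_not_stepAccurate_le (hP : P.Standing lf lg Lg lhat Lhat)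
    (hs : SolverGuarantee P M ν solver) (hε : 0 < εbar) (hδ : 0 < δbar) {κa κb δa δb : ℝ}
    (hA : BatchConcentrates N a (E m) κa δa) (hB : BatchConcentrates N b (Jac n m) κb δb)
    (i : ℕ) {x₀ x : E n} (hi : i = 0 → x = x₀) :
    noiseLaw N a b ν {z | ¬ StepAccurate P M solver εbar δbar (κa * lhat) (κb * Lhat) i x₀ x z} ≤
      ENNReal.ofReal δa + ENNReal.ofReal δb + ENNReal.ofReal δbar := by
  set SA : Set (Fin a → Fin N) := {A | κa * (lhat * ‖x - x₀‖) <
    ‖avg (fun s => P.comp (A s) x - P.comp (A s) x₀) -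
      avg fun j => P.comp j x - P.comp j x₀‖} with hSA
  set SB : Set (Fin b → Fin N) := {B | κb * (Lhat * ‖x - x₀‖) <
    ‖avg (fun s => fderiv ℝ (P.comp (B s)) x - fderiv ℝ (P.comp (B s)) x₀) -
      avg fun j => fderiv ℝ (P.comp j) x - fderiv ℝ (P.comp j) x₀‖} with hSB
  set F : Set (Noise N a b S) := {z |
    ¬ P.model M (estimateAt P i x₀ x z.1 z.2.1).1 (estimateAt P i x₀ x z.1 z.2.1).2 x
      (innerStep P M solver εbar δbar i x₀ x z) ≤
    (⨅ y, P.model M (estimateAt P i x₀ x z.1 z.2.1).1 (estimateAt P i x₀ x z.1 z.2.1).2 x y) +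
      (εbar : EReal)} with hF
  have hsub : {z | ¬ StepAccurate P M solver εbar δbar (κa * lhat) (κb * Lhat) i x₀ x z} ⊆
      (SA ×ˢ univ ∪ univ ×ˢ (SB ×ˢ univ)) ∪ F := by
    intro z hz
    by_contra hcon
    simp only [mem_union, mem_prod, mem_univ, and_true, true_and, not_or, hSA, hSB, hF,
      mem_ofPred_eq, not_lt, not_not] at hcon
    obtain ⟨⟨h1, h2⟩, h3⟩ := hcon
    refine hz ⟨?_, ?_, h3⟩
    -- At `i = 0` the state is the epoch's first point, where the estimate is exact; both sides
    -- vanish.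
    · by_cases h0 : i = 0
      · subst h0
        rw [estimateAt_zero, hi rfl]; simp
      · rw [estimateAt_of_ne_zero h0, mul_assoc]
        rw [avg_sub (fun j => P.comp j x)] at h1
        refine le_trans (le_of_eq ?_) h1
        congr 1
        simp only [Problem.g]; abel
    · by_cases h0 : i = 0
      · subst h0
        rw [estimateAt_zero, hi rfl, hP.fderiv_g]; simp
      · rw [estimateAt_of_ne_zero h0, mul_assoc, hP.fderiv_g]
        rw [avg_sub (fun j => fderiv ℝ (P.comp j) x)] at h2
        refine le_trans (le_of_eq ?_) h2
        congr 1
        simp only; abel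
  refine (measure_mono hsub).trans ((measure_union_le _ _).trans (add_le_add
    ((measure_union_le _ _).trans (add_le_add ?_ ?_)) ?_))
  · rw [noiseLaw, Measure.prod_prod, measure_univ, mul_one]
    refine hA (fun j => P.comp j x - P.comp j x₀) _ fun j => ?_
    rw [← dist_eq_norm, ← dist_eq_norm]
    exact (hP.comp_lipschitz j).dist_le_mul x x₀
  · rw [noiseLaw, Measure.prod_prod, Measure.prod_prod, measure_univ, measure_univ, mul_one,
      one_mul]
    refine hB (fun j => fderiv ℝ (P.comp j) x - fderiv ℝ (P.comp j) x₀) _ fun j => ?_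
    rw [← dist_eq_norm, ← dist_eq_norm]
    exact (hP.comp_jac_lipschitz j).dist_le_mul x x₀
  · have hd := (measurable_modelData (a := a) (b := b) (S := S) hP i).comp
      (measurable_prodMk_left (x := (x₀, x)))
    have hx := (measurable_innerStep (a := a) (b := b) hP hs hε hδ i).comp
      (measurable_prodMk_left (x := (x₀, x)))
    have hFm : MeasurableSet F := (measurableSet_le
      ((hP.measurable_model (M := M)).comp (hd.prodMk hx))
      (((hP.measurable_iInf_model (M := M)).comp hd).add
        (measurable_const (a := (εbar : EReal))))).compl
    -- The solver guarantee holds for all model data, so both batches can be frozen and only the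
    -- seed integrated.
    refine prod_apply_le _ _ hFm fun A => ?_
    refine prod_apply_le _ _ (measurable_prodMk_left hFm) fun B => ?_
    refine (measure_mono fun ζ hζ => ?_).trans (measure_solver_fails_le hP hs hε hδ
      (estimateAt P i x₀ x A B).1 (estimateAt P i x₀ x A B).2 x)
    have hζ' : (A, B, ζ) ∈ F := hζ
    simp only [hF, mem_ofPred_eq, innerStep_eq] at hζ'
    exact hζ'

/-- All inner iterations of `K` epochs are accurate with large probability. -/
lemma runLaw_exists_not_stepAccurate_le (hP : P.Standing lf lg Lg lhat Lhat)
    (hs : SolverGuarantee P M ν solver) (hε : 0 < εbar) (hδ : 0 < δbar) {κa κb δa δb : ℝ}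
    (hA : BatchConcentrates N a (E m) κa δa) (hB : BatchConcentrates N b (Jac n m) κb δb)
    (K τ : ℕ) (x₀ : E n) :
    runLaw N a b ν {ω | ∀ k < K, ∀ i < τ,
      StepAccurate P M solver εbar δbar (κa * lhat) (κb * Lhat) i
        (iterate P M solver εbar δbar τ x₀ ω k 0) (iterate P M solver εbar δbar τ x₀ ω k i)
        (ω (k, i))}ᶜ ≤
      K * (τ * (ENNReal.ofReal δa + ENNReal.ofReal δb + ENNReal.ofReal δbar)) := by
  set c := ENNReal.ofReal δa + ENNReal.ofReal δb + ENNReal.ofReal δbar with hc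
  set bad : ℕ → ℕ → Set (ℕ × ℕ → Noise N a b S) := fun k i => {ω |
    ¬ StepAccurate P M solver εbar δbar (κa * lhat) (κb * Lhat) i
        (iterate P M solver εbar δbar τ x₀ ω k 0) (iterate P M solver εbar δbar τ x₀ ω k i)
        (ω (k, i))} with hbad
  have hone : ∀ k i, runLaw N a b ν (bad k i) ≤ c := by
    intro k i
    refine infinitePi_state_le (noiseLaw N a b ν) (k, i)
      (f := fun ω => (iterate P M solver εbar δbar τ x₀ ω k 0,
        iterate P M solver εbar δbar τ x₀ ω k i))
      (B := {p | StepAccurate P M solver εbar δbar (κa * lhat) (κb * Lhat) i p.1.1 p.1.2 p.2}ᶜ)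
      ((measurable_iterate hP hs hε hδ τ x₀ k 0).prodMk (measurable_iterate hP hs hε hδ τ x₀ k i))
      ?_ (measurableSet_stepAccurate hP hs hε hδ _ _ i).compl ?_
    · intro w x
      have : ∀ j ≤ i, iterate P M solver εbar δbar τ x₀ (Function.update w (k, i) x) k j =
          iterate P M solver εbar δbar τ x₀ w k j := by
        intro j hj
        refine iterate_congr τ x₀ k j fun k' i' h => Function.update_of_ne ?_ _ _
        simp only [ne_eq, Prod.mk.injEq]; omega
      rw [this 0 (Nat.zero_le _), this i le_rfl]
    · intro w
      exact noiseLaw_not_stepAccurate_le hP hs hε hδ hA hB i (by rintro rfl; rfl)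
  calc _ ≤ runLaw N a b ν (⋃ k ∈ Finset.range K, ⋃ i ∈ Finset.range τ, bad k i) := by
        refine measure_mono fun ω hω => ?_
        simp only [mem_compl_iff, mem_ofPred_eq, not_forall] at hω
        obtain ⟨k, hk, i, hi, h⟩ := hω
        exact mem_biUnion (Finset.mem_coe.2 (Finset.mem_range.2 hk))
          (mem_biUnion (Finset.mem_coe.2 (Finset.mem_range.2 hi)) h)
    _ ≤ ∑ k ∈ Finset.range K, ∑ i ∈ Finset.range τ, c :=
        (measure_biUnion_finset_le _ _).trans (Finset.sum_le_sum fun k _ =>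
          (measure_biUnion_finset_le _ _).trans (Finset.sum_le_sum fun i _ => hone k i))
    _ = _ := by simp

end Accuracy

/-! ### Parameters -/

/-- Serves both counts: `X = ε⁻¹` for values and `X = 1` for Jacobians, with `e = ε⁻¹`. The two `+
1` come from the ceilings and are absorbed by `τ ≤ X τ³` and `e ≤ e X τ²`. -/
lemma total_calls_le {K N τ a e X A Cs c0 L C : ℝ} (hN : 0 ≤ N) (hτ : 1 ≤ τ) (he : 1 ≤ e)
    (hX : 1 ≤ X) (hA : 0 ≤ A) (hCs : 0 ≤ Cs) (hc0 : 0 ≤ c0) (hL : 1 ≤ L) (ha0 : 0 ≤ a)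
    (hK : K ≤ Cs * e / τ + 1) (ha : a ≤ A * τ ^ 2 * X * (c0 * L) + 1)
    (hC : (1 + Cs) * (1 + A * c0) ≤ C) :
    K * (N + τ * a) ≤ C * L * (N + X * τ ^ 3 + N * e * τ⁻¹ + e * X * τ ^ 2) := by
  have hτ0 : 0 < τ := by linarith
  set B := A * c0 with hB
  have hB0 : 0 ≤ B := mul_nonneg hA hc0
  have hbracket : 0 ≤ N + X * τ ^ 3 + N * e * τ⁻¹ + e * X * τ ^ 2 := by positivity
  have h1 : K * (N + τ * a) ≤ (Cs * e / τ + 1) * (N + τ * (A * τ ^ 2 * X * (c0 * L) + 1)) := by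
    gcongr
  have h2 : (Cs * e / τ + 1) * (N + τ * (A * τ ^ 2 * X * (c0 * L) + 1)) =
      N + Cs * (N * e * τ⁻¹) + (B * L * (X * τ ^ 3) + τ) +
        Cs * (B * L * (e * X * τ ^ 2) + e) := by
    rw [hB]; field_simp; ring
  have h3 : τ ≤ L * (X * τ ^ 3) := by
    have : (1 : ℝ) * (1 * τ ^ 1) ≤ L * (X * τ ^ 3) := by
      gcongr
      · norm_num
    simpa using this
  have h4 : e ≤ L * (e * X * τ ^ 2) := by
    have : (1 : ℝ) * (e * 1 * 1 ^ 2) ≤ L * (e * X * τ ^ 2) := by gcongr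
    simpa using this
  have h5 : N ≤ L * N := le_mul_of_one_le_left hN hL
  have h6 : N * e * τ⁻¹ ≤ L * (N * e * τ⁻¹) := le_mul_of_one_le_left (by positivity) hL
  have h7 := mul_le_mul_of_nonneg_left h6 hCs
  have h8 := mul_le_mul_of_nonneg_left h4 hCs
  have h9 : 0 ≤ L * N := by positivity
  have h10 : 0 ≤ L * (N * e * τ⁻¹) := by positivity
  have h11 : 0 ≤ L * (X * τ ^ 3) := by positivity
  have h12 : 0 ≤ L * (e * X * τ ^ 2) := by positivity
  calc _ ≤ (1 + Cs) * (1 + B) * (L * (N + X * τ ^ 3 + N * e * τ⁻¹ + e * X * τ ^ 2)) := by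
        refine (h1.trans_eq h2).trans ?_
        have e1 := mul_nonneg hCs h9
        have e2 := mul_nonneg hB0 h9
        have e3 := mul_nonneg (mul_nonneg hCs hB0) h9
        have e5 := mul_nonneg hB0 h10
        have e6 := mul_nonneg (mul_nonneg hCs hB0) h10
        have e7 := mul_nonneg hCs h11
        have e9 := mul_nonneg (mul_nonneg hCs hB0) h11
        have e11 := mul_nonneg hB0 h12
        nlinarith
    _ ≤ C * (L * (N + X * τ ^ 3 + N * e * τ⁻¹ + e * X * τ ^ 2)) := by gcongr
    _ = _ := by ring

lemma one_le_log_of_four_le {x : ℝ} (hx : 4 ≤ x) : 1 ≤ Real.log x := by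
  rw [Real.le_log_iff_exp_le (by linarith)]
  linarith [Real.exp_one_lt_d9]

lemma log_le_mul_one_add_log {x c q : ℝ} (hx : 0 ≤ x) (hc : 1 ≤ c) (hq : 1 ≤ q)
    (h : x ≤ c * q) : Real.log x ≤ (1 + Real.log c) * (1 + Real.log q) := by
  have h1 := Real.log_nonneg hc
  have h2 := Real.log_nonneg hq
  rcases hx.eq_or_lt with rfl | hx
  · rw [Real.log_zero]; positivity
  · calc _ ≤ Real.log (c * q) := Real.log_le_log hx h
      _ = Real.log c + Real.log q := Real.log_mul (by positivity) (by positivity)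
      _ ≤ _ := by nlinarith

lemma batchConcentrates_vector {N r m : ℕ} [NeZero N] {κ δ : ℝ} (hκ : 0 < κ) (hδ : 0 < δ)
    (hl : 4 ≤ (m + 1) / δ) (hr : 8 * Real.exp 1 * Real.log ((m + 1) / δ) ≤ r * κ ^ 2) :
    BatchConcentrates N r (E m) κ δ :=
  fun v _ hv => measure_vector_deviation_le v hv hκ hδ (one_le_log_of_four_le hl) hr

lemma batchConcentrates_jac {N r n m : ℕ} [NeZero N] {κ δ : ℝ} (hκ : 0 < κ) (hδ : 0 < δ)
    (hl : 1 ≤ m + n → 4 ≤ (m + n) / δ)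
    (hr : 8 * Real.exp 1 * Real.log ((m + n) / δ) ≤ r * κ ^ 2) :
    BatchConcentrates N r (Jac n m) κ δ := by
  intro v R hv
  -- For `m = n = 0` the logarithm is `log 0 = 0` and the batch may be empty, but the space of
  -- Jacobians is trivial.
  rcases Nat.eq_zero_or_pos (m + n) with h | h
  · obtain rfl : n = 0 := by omega
    have hR : 0 ≤ κ * R :=
      mul_nonneg hκ.le ((norm_nonneg _).trans (hv ⟨0, Nat.pos_of_ne_zero (NeZero.ne N)⟩))
    have : {A : Fin r → Fin N | κ * R < ‖avg (fun s => v (A s)) - avg v‖} = ∅ := by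
      refine eq_empty_of_forall_notMem fun A hA => ?_
      have h0 : avg (fun s => v (A s)) - avg v = 0 := Subsingleton.elim _ _
      simp only [mem_ofPred_eq, h0, norm_zero] at hA
      linarith
    rw [this, measure_empty]; exact zero_le
  · exact measure_deviation_le v hv hκ hδ (one_le_log_of_four_le (hl h)) hr

instance {N a b : ℕ} [NeZero N] {S : Type*} [MeasurableSpace S] (ν : Measure S)
    [IsProbabilityMeasure ν] : IsProbabilityMeasure (runLaw N a b ν) := by
  unfold runLaw; infer_instance

/-- Subadditivity suffices, so neither `G` nor `H` has to be measurable; in particular nothing is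
needed about `proxPoint` as a function. -/
lemma ofReal_one_sub_le_of_compl_le {Ω : Type*} [MeasurableSpace Ω] (μ : Measure Ω)
    [IsProbabilityMeasure μ] {G H : Set Ω} (hGH : G ⊆ H) {Δ : ℝ}
    (h : μ Gᶜ ≤ ENNReal.ofReal Δ) (hΔ : 0 ≤ Δ) : ENNReal.ofReal (1 - Δ) ≤ μ H := by
  rw [ENNReal.ofReal_sub _ hΔ, ENNReal.ofReal_one, tsub_le_iff_right, ← measure_univ (μ := μ)]
  calc μ univ ≤ μ G + μ Gᶜ := by rw [← union_compl_self G]; exact measure_union_le _ _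
    _ ≤ _ := add_le_add (measure_mono hGH) h

lemma Problem.Standing.exists_real_lower_bound {n m N : ℕ} {P : Problem n m N}
    {lf lg Lg lhat Lhat : ℝ≥0} (hP : P.Standing lf lg Lg lhat Lhat) {x₀ : E n} {D : ℝ}
    (hinf : ⊥ < ⨅ x, P.obj x) (hx₀ : P.obj x₀ ≤ (⨅ x, P.obj x) + (D : EReal)) :
    ∃ φ : ℝ, (∀ y, (φ : EReal) ≤ P.obj y) ∧ P.h x₀ ≠ ⊤ ∧ P.realObj x₀ ≤ φ + D := by
  obtain ⟨y, hy⟩ := hP.h_proper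
  have htop : (⨅ x, P.obj x) ≠ ⊤ := by
    refine ((iInf_le _ y).trans_lt ?_).ne
    rw [hP.obj_eq hy]; exact EReal.coe_lt_top _
  have hφ : (((⨅ x, P.obj x).toReal : ℝ) : EReal) = ⨅ x, P.obj x :=
    EReal.coe_toReal htop hinf.ne'
  rw [← hφ, ← EReal.coe_add] at hx₀
  have hh : P.h x₀ ≠ ⊤ := by
    intro h
    rw [Problem.obj, h, EReal.coe_add_top] at hx₀
    exact absurd hx₀ (not_le.2 (EReal.coe_lt_top _))
  refine ⟨(⨅ x, P.obj x).toReal, fun y => hφ.le.trans (iInf_le _ y), hh, ?_⟩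
  rwa [hP.obj_eq hh, EReal.coe_le_coe_iff] at hx₀

/-- Convergence for batches of the stated sizes. -/
lemma convergence {lf lg Lg lhat Lhat : ℝ≥0} {M D Csum α β : ℝ} (hM : 5 * (lf : ℝ) * Lg < M)
    (hCsum : 5 * M * D ≤ Csum) (hα : 0 < α) (hβ : 0 < β) (hlα : lf * (α * lhat) ≤ 1 / 100)
    (hlβ : lf * (β * Lhat) ≤ M / 10) {n m N a b : ℕ} [NeZero N] {P : Problem n m N} {x₀ : E n}
    {S : Type*} [MeasurableSpace S] {ν : Measure S} [IsProbabilityMeasure ν] {solver : Solver n S}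
    (hP : P.Standing lf lg Lg lhat Lhat) (hinf : ⊥ < ⨅ x, P.obj x)
    (hx₀ : P.obj x₀ ≤ (⨅ x, P.obj x) + (D : EReal)) (hs : SolverGuarantee P M ν solver)
    {Δ : ℝ} (hΔ : 0 < Δ) (hΔ1 : Δ < 1) {τ : ℕ} (hτ : 0 < τ) {ε : ℝ} (hε : 0 < ε) {K : ℕ}
    {δbar εbar : ℝ} (hK : 0 < K) (hKge : Csum * ε⁻¹ / τ ≤ K)
    (ha : 8 * Real.exp 1 / α ^ 2 * (τ : ℝ) ^ 2 * ε⁻¹ * Real.log (4 * (m + 1) * K * τ / Δ) ≤ a)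
    (hb : 8 * Real.exp 1 / β ^ 2 * (τ : ℝ) ^ 2 * Real.log (4 * (m + n) * K * τ / Δ) ≤ b)
    (hδbar : δbar = Δ / (2 * K * τ)) (hεbar : εbar = ε / (5 * 30 * M)) :
    ENNReal.ofReal (1 - Δ) ≤ runLaw N a b ν
      {ω | 1 / ((K : ℝ) * τ) * ∑ k ∈ Finset.range K, ∑ i ∈ Finset.range τ,
        ‖P.genGrad M (iterate P M solver εbar δbar τ x₀ ω k i)‖ ^ 2 ≤ ε} := by
  have hM0 : 0 < M := lt_of_le_of_lt (by positivity) hM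
  have hτ' : (0 : ℝ) < τ := by exact_mod_cast hτ
  have hK' : (0 : ℝ) < K := by exact_mod_cast hK
  have hτ1 : (1 : ℝ) ≤ τ := by exact_mod_cast hτ
  have hK1 : (1 : ℝ) ≤ K := by exact_mod_cast hK
  have hsε := Real.sqrt_pos.2 hε
  obtain ⟨φ, hφ, hh, hD⟩ := hP.exists_real_lower_bound hinf hx₀
  have hδ0 : 0 < δbar := by rw [hδbar]; positivity
  have hε0 : 0 < εbar := by rw [hεbar]; positivity
  -- The budget per iteration is `Δ / (Kτ)`: a quarter for each batch and half for the solver.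
  set δ := Δ / (4 * K * τ) with hδ
  have hδpos : 0 < δ := by positivity
  have hlog : ∀ d : ℝ, 4 * d * K * τ / Δ = d / δ := by
    intro d; rw [hδ]; field_simp
  have hfour : ∀ d : ℝ, 1 ≤ d → 4 ≤ d / δ := by
    intro d hd
    rw [le_div_iff₀ hδpos, hδ, ← mul_div_assoc, div_le_iff₀ (by positivity)]
    have : (1 : ℝ) ≤ d * K * τ := by
      calc (1 : ℝ) = 1 * 1 * 1 := by norm_num
        _ ≤ _ := by gcongr
    linarith
  rw [hlog] at ha hb
  -- Values need relative accuracy of order `√ε / τ`, Jacobians only `1 / τ`; hence the extra `ε⁻¹`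
  -- in `a`.
  have hA : BatchConcentrates N a (E m) (α * Real.sqrt ε / τ) δ := by
    refine batchConcentrates_vector (by positivity) hδpos (hfour _ (by simp)) ?_
    have : (α * Real.sqrt ε / τ) ^ 2 = α ^ 2 * ε / τ ^ 2 := by
      rw [div_pow, mul_pow, Real.sq_sqrt hε.le]
    rw [this]
    have h2 := mul_le_mul_of_nonneg_right ha (by positivity : 0 ≤ α ^ 2 * ε / (τ : ℝ) ^ 2)
    refine le_trans (le_of_eq ?_) h2
    field_simp
  have hB : BatchConcentrates N b (Jac n m) (β / τ) δ := by
    refine batchConcentrates_jac (by positivity) hδpos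
      (fun h => hfour _ (by exact_mod_cast h)) ?_
    have h2 := mul_le_mul_of_nonneg_right hb (by positivity : 0 ≤ (β / (τ : ℝ)) ^ 2)
    refine le_trans (le_of_eq ?_) h2
    field_simp
  have hrun := runLaw_exists_not_stepAccurate_le hP hs hε0 hδ0 hA hB K τ x₀
  refine ofReal_one_sub_le_of_compl_le _ (fun ω hω => ?_) (hrun.trans (le_of_eq ?_)) hΔ.le
  · refine average_genGrad_le hP hM hφ hτ hε ?_ ?_ hh hD hK ?_ hεbar hω
    · calc _ = lf * (α * lhat) * (Real.sqrt ε / τ) := by ring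
        _ ≤ 1 / 100 * (Real.sqrt ε / τ) := by gcongr
        _ = _ := by field_simp
    · calc _ = lf * (β * Lhat) * (1 / τ) := by ring
        _ ≤ M / 10 * (1 / τ) := by gcongr
        _ = _ := by field_simp
    · refine hCsum.trans ?_
      rw [div_le_iff₀ hτ', ← div_eq_mul_inv, div_le_iff₀ hε] at hKge
      exact hKge
  · rw [← ENNReal.ofReal_add hδpos.le hδpos.le, ← ENNReal.ofReal_add (by positivity) hδ0.le,
      ← ENNReal.ofReal_natCast K, ← ENNReal.ofReal_natCast τ,
      ← ENNReal.ofReal_mul (by positivity), ← ENNReal.ofReal_mul (by positivity)]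
    congr 1
    rw [hδ, hδbar]; field_simp; norm_num

end ProxSVRG

/-! ### Choice of the constants and conclusion -/

theorem corollary6 (lf lg Lg lhat Lhat : ℝ≥0) (M D : ℝ) (hM : 5 * (lf : ℝ) * (Lg : ℝ) < M) :
    ∃ Csum > (0 : ℝ), ∃ Ca > (0 : ℝ), ∃ Cb > (0 : ℝ), ∃ C > (0 : ℝ), ∃ ε₀ > (0 : ℝ),
      ∀ (n m N : ℕ) [NeZero N] (P : ProxSVRG.Problem n m N) (x₀ : ProxSVRG.E n)
        (S : Type*) [MeasurableSpace S] (ν : Measure S) [IsProbabilityMeasure ν]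
        (solver : ProxSVRG.Solver n S),
        P.Standing lf lg Lg lhat Lhat →
        ⊥ < (⨅ x, P.obj x) →
        P.obj x₀ ≤ (⨅ x, P.obj x) + (D : EReal) →
        ProxSVRG.SolverGuarantee P M ν solver →
        ∀ (Δ : ℝ), 0 < Δ → Δ < 1 → ∀ (τ : ℕ), 0 < τ → ∀ (ε : ℝ), 0 < ε → ε ≤ ε₀ →
        ∀ (K a b : ℕ) (δbar εbar : ℝ),
          K = ⌈Csum * ε⁻¹ / τ⌉₊ →
          a = ⌈Ca * (τ : ℝ) ^ 2 * ε⁻¹ * Real.log (4 * (m + 1) * K * τ / Δ)⌉₊ →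
          b = ⌈Cb * (τ : ℝ) ^ 2 * Real.log (4 * (m + n) * K * τ / Δ)⌉₊ →
          δbar = Δ / (2 * K * τ) →
          εbar = ε / (5 * 30 * M) →
          -- with probability at least `1 - Δ`, the average squared generalized gradient is small
          ENNReal.ofReal (1 - Δ) ≤ ProxSVRG.runLaw N a b ν
              {ω | 1 / ((K : ℝ) * τ) * ∑ k ∈ Finset.range K, ∑ i ∈ Finset.range τ,
                ‖P.genGrad M (ProxSVRG.iterate P M solver εbar δbar τ x₀ ω k i)‖ ^ 2 ≤ ε} ∧
          -- the numbers of component evaluations and of component Jacobians, in every run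
          ∀ ω : ℕ × ℕ → ProxSVRG.Noise N a b S,
            ((ProxSVRG.method P M solver εbar δbar τ x₀ ω K).evals : ℝ) ≤
              C * (1 + Real.log ((m + n + 1) * τ / (ε * Δ))) *
                (N + ε⁻¹ * (τ : ℝ) ^ 3 + N * ε⁻¹ * (τ : ℝ)⁻¹ + (ε ^ 2)⁻¹ * (τ : ℝ) ^ 2) ∧
            ((ProxSVRG.method P M solver εbar δbar τ x₀ ω K).jacs : ℝ) ≤
              C * (1 + Real.log ((m + n + 1) * τ / (ε * Δ))) *
                (N + (τ : ℝ) ^ 3 + N * ε⁻¹ * (τ : ℝ)⁻¹ + ε⁻¹ * (τ : ℝ) ^ 2) := by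
  have hM0 : 0 < M := lt_of_le_of_lt (by positivity) hM
  have hlf : (0 : ℝ) ≤ lf := lf.2
  have hlh : (0 : ℝ) ≤ lhat := lhat.2
  have hLh : (0 : ℝ) ≤ Lhat := Lhat.2
  -- The summands `1 +` avoid division by zero when a Lipschitz constant vanishes.
  set α : ℝ := 1 / (100 * ((1 + lf) * (1 + lhat))) with hα
  set β : ℝ := M / (10 * ((1 + lf) * (1 + Lhat))) with hβ
  -- `D` has no assumed sign; the maximum and the `+ 1` ensure `Csum ≥ 1`.
  set Csum : ℝ := 5 * M * max D 0 + 1 with hCsum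
  have hα0 : 0 < α := by positivity
  have hβ0 : 0 < β := by positivity
  have hCs1 : 1 ≤ Csum := by
    have : 0 ≤ 5 * M * max D 0 := by positivity
    linarith
  set Ca : ℝ := 8 * Real.exp 1 / α ^ 2 with hCa
  set Cb : ℝ := 8 * Real.exp 1 / β ^ 2 with hCb
  have hCa0 : 0 < Ca := by positivity
  have hCb0 : 0 < Cb := by positivity
  -- The arguments of the logarithms in `a` and `b` are at most `4 (Csum + 1) q`, because `Kτ ≤
  -- (Csum + 1) τ / ε` when `ε ≤ 1`.
  set c0 : ℝ := 1 + Real.log (4 * (Csum + 1)) with hc0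
  have hc00 : 0 ≤ c0 := by
    have := Real.log_nonneg (by linarith : 1 ≤ 4 * (Csum + 1))
    linarith
  have hlα : lf * (α * lhat) ≤ 1 / 100 := by
    rw [hα, one_div_mul_eq_div, ← mul_div_assoc, div_le_div_iff₀ (by positivity) (by norm_num)]
    nlinarith
  have hlβ : lf * (β * Lhat) ≤ M / 10 := by
    have h1 : (lf : ℝ) * Lhat ≤ (1 + lf) * (1 + Lhat) := by nlinarith
    calc _ = M * (lf * Lhat) / (10 * ((1 + lf) * (1 + Lhat))) := by rw [hβ]; ring
      _ ≤ M * ((1 + lf) * (1 + Lhat)) / (10 * ((1 + lf) * (1 + Lhat))) := by gcongr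
      _ = _ := by field_simp
  have hCD : 5 * M * D ≤ Csum := by
    have := mul_le_mul_of_nonneg_left (le_max_left D 0) (by positivity : 0 ≤ 5 * M)
    linarith
  refine ⟨Csum, by linarith, Ca, hCa0, Cb, hCb0, (1 + Csum) * (1 + (Ca + Cb) * c0),
    by positivity, 1, one_pos, ?_⟩
  intro n m N _ P x₀ S _ ν _ solver hP hinf hx₀ hs Δ hΔ hΔ1 τ hτ ε hε hε1 K a b δbar εbar
    hK ha hb hδbar hεbar
  have hτ1 : (1 : ℝ) ≤ τ := by exact_mod_cast hτ
  have he : 1 ≤ ε⁻¹ := (one_le_inv₀ hε).2 hε1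
  have hKpos : 0 < K := by rw [hK]; exact Nat.ceil_pos.2 (by positivity)
  have hKge : Csum * ε⁻¹ / τ ≤ K := by rw [hK]; exact Nat.le_ceil _
  have hKle : (K : ℝ) ≤ Csum * ε⁻¹ / τ + 1 := by
    rw [hK]; exact (Nat.ceil_lt_add_one (by positivity)).le
  refine ⟨ProxSVRG.convergence hM hCD hα0 hβ0 hlα hlβ hP hinf hx₀ hs hΔ hΔ1 hτ hε hKpos hKge
    (by rw [ha]; exact Nat.le_ceil _) (by rw [hb]; exact Nat.le_ceil _) hδbar hεbar, fun ω => ?_⟩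
  set q : ℝ := (m + n + 1) * τ / (ε * Δ) with hq
  have hq1 : 1 ≤ q := by
    rw [hq, one_le_div (by positivity)]
    calc ε * Δ ≤ 1 * 1 := by gcongr
      _ ≤ (m + n + 1) * τ := by
        gcongr
        have : (0 : ℝ) ≤ m + n := by positivity
        linarith
  have hL1 : 1 ≤ 1 + Real.log q := by linarith [Real.log_nonneg hq1]
  have hKτ : (K : ℝ) * τ ≤ (Csum + 1) * (τ * ε⁻¹) := by
    calc (K : ℝ) * τ ≤ (Csum * ε⁻¹ / τ + 1) * τ := by gcongr
      _ = Csum * (1 * ε⁻¹) + τ * 1 := by field_simp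
      _ ≤ Csum * (τ * ε⁻¹) + τ * ε⁻¹ := by gcongr
      _ = _ := by ring
  have hlog : ∀ d : ℝ, 0 ≤ d → d ≤ m + n + 1 →
      Real.log (4 * d * K * τ / Δ) ≤ c0 * (1 + Real.log q) := by
    intro d hd0 hd
    refine ProxSVRG.log_le_mul_one_add_log (by positivity) (by linarith) hq1 ?_
    calc 4 * d * K * τ / Δ = 4 * (d * (K * τ)) / Δ := by ring
      _ ≤ 4 * ((m + n + 1) * ((Csum + 1) * (τ * ε⁻¹))) / Δ := by gcongr
      _ = _ := by rw [hq]; field_simp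
  have hlog0 : ∀ d : ℝ, 0 ≤ d → (d = 0 ∨ 1 ≤ d) → 0 ≤ Real.log (4 * d * K * τ / Δ) := by
    rintro d hd0 (rfl | hd)
    · simp
    · refine Real.log_nonneg ?_
      rw [one_le_div hΔ]
      have hK1 : (1 : ℝ) ≤ K := by exact_mod_cast hKpos
      calc Δ ≤ 4 * 1 * 1 * 1 := by linarith
        _ ≤ _ := by gcongr
  have hm0 : (0 : ℝ) ≤ m := Nat.cast_nonneg m
  have hn0 : (0 : ℝ) ≤ n := Nat.cast_nonneg n
  have hmn : (m + n : ℝ) = 0 ∨ (1 : ℝ) ≤ m + n := by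
    rcases Nat.eq_zero_or_pos (m + n) with h | h
    · exact Or.inl (by exact_mod_cast h)
    · exact Or.inr (by exact_mod_cast h)
  constructor
  · have ha' : (a : ℝ) ≤ Ca * (τ : ℝ) ^ 2 * ε⁻¹ * (c0 * (1 + Real.log q)) + 1 := by
      have h0 := hlog0 (m + 1) (by positivity) (Or.inr (by linarith))
      rw [ha]
      refine (Nat.ceil_lt_add_one (by positivity)).le.trans ?_
      gcongr
      exact hlog (m + 1) (by positivity) (by linarith)
    have h1 := ProxSVRG.total_calls_le (C := (1 + Csum) * (1 + (Ca + Cb) * c0))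
      (Nat.cast_nonneg N) hτ1 he he hCa0.le
      (by linarith) hc00 hL1 (Nat.cast_nonneg a) hKle ha'
      (by gcongr; linarith)
    have h2 : ((ProxSVRG.method P M solver εbar δbar τ x₀ ω K).evals : ℝ) ≤ K * (N + τ * a) := by
      exact_mod_cast ProxSVRG.method_evals_le P M solver εbar δbar τ x₀ ω K
    refine h2.trans (h1.trans_eq ?_)
    rw [sq ε, mul_inv]
  · have hb' : (b : ℝ) ≤ Cb * (τ : ℝ) ^ 2 * 1 * (c0 * (1 + Real.log q)) + 1 := by
      have h0 := hlog0 (m + n) (by positivity) hmn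
      rw [hb, mul_one]
      refine (Nat.ceil_lt_add_one (by positivity)).le.trans ?_
      gcongr
      exact hlog (m + n) (by positivity) (by linarith)
    have h1 := ProxSVRG.total_calls_le (C := (1 + Csum) * (1 + (Ca + Cb) * c0))
      (Nat.cast_nonneg N) hτ1 he le_rfl hCb0.le
      (by linarith) hc00 hL1 (Nat.cast_nonneg b) hKle hb'
      (by gcongr; linarith)
    have h2 : ((ProxSVRG.method P M solver εbar δbar τ x₀ ω K).jacs : ℝ) ≤ K * (N + τ * b) := by
      exact_mod_cast ProxSVRG.method_jacs_le P M solver εbar δbar τ x₀ ω K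
    refine h2.trans (h1.trans_eq ?_)
    rw [one_mul, mul_one]
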